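/- Let $\Lambda_{\ge0}$ be the Novikov ring with $\mathbb C$-coefficients (formal sums $\sum a_iT^{\lambda_i}$, $a_i\in\mathbb C$, $\lambda_i\in\mathbb R_{\ge0}$, with finitely many nonzero terms below every energy level). All filtered $A_\infty$ algebras and bimodules below are $\mathbb Z$-graded with underlying module a completed free module $\bar V\mathbin{\hat\otimes}_{\mathbb C}\Lambda_{\ge0}$, filtered by the submodules generated by $T^{\lambda}$; the products $m^k$ of an algebra have degree $2-k$, and the products $m^{k_1|1|k_2}$ of a bimodule have degree $1-k_1-k_2$. A structure is gapped if its products decompose as $m=\sum_{\beta\in G}T^{\omega(\beta)}m^{\beta}$, with $G$ a finitely generated commutative monoid, $\omega\colon G\to\mathbb R_{\ge0}$ a monoid homomorphism with $\omega^{-1}(0)=\{0\}$, and $m^\beta$ induced by graded $\mathbb C$-multilinear maps of the spaces $\bar V$; a gapped homomorphism decomposes in the same way over the monoid of its target and comes with an $\omega$-preserving map from the monoid of its source to that of its target, and for a gapped bimodule over gapped algebras the monoids of the algebras come with $\omega$-preserving maps to that of the bimodule. Let $A$ and $B$ be gapped filtered $A_\infty$ algebras which are tautologically unobstructed ($m^0_A=0$,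 $m^0_B=0$), and let $M$ be a gapped filtered $A_\infty$ $(A,B)$-bimodule. Suppose that $A$ has an anti-commutative DGA model: there are a gapped anti-commutative differential graded algebra $\bar A$ over $\Lambda_{\ge0}$ (that is, a gapped filtered $A_\infty$ algebra with $m^k=0$ for $k\ne1,2$ and with $x\cdot y=(-1)^{|x||y|}y\cdot x$ for $x\cdot y=(-1)^{|x|}m^2(x,y)$) and gapped $A_\infty$ homomorphisms $f=(f^k)_{k\ge1}\colon A\to\bar A$ and $g=(g^k)_{k\ge1}\colon\bar A\to A$ such that $g\circ f$ and $f\circ g$ are $A_\infty$ homotopic to the identities. Let $0\le\lambda_0<\lambda_1$ be real numbers such that (i) the maps $m^{k|1|0}_{A|M|B}\colon A^{\otimes k}\otimes M\to M$, $k\ge0$, all have image contained in $T^{\lambda_0}M$; and (ii) there is $\underline e\in M^0$ with $m^{0|1|0}_{A|M|B}(\underline e)\in T^{\lambda_1}M$ (a degree-$0$ cocycle of $M/T^{\lambda_1}M$) such that the induced map $$H^1(A)\to H^1(T^{\lambda_0}M/T^{\lambda_1}M),\qquad [a]\mapsto[m^{1|1|0}_{A|M|B}(a\otimes\underline e)]$$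 is surjective. Then there exist a bounding cochain $a$ of $A$ (an element $a\in A^1$ of positive valuation with $\sum_{k\ge0}m^k_A(a^{\otimes k})=0$) and an element $e\in M^0$ with $e\equiv\underline e\bmod T^{\lambda_1}M$ (so $e\neq0$ whenever $\underline e\notin T^{\lambda_1}M$) such that $$m^{0|1|0}_{(A,a)|M|B}(e)=\sum_{k\ge0}m^{k|1|0}_{A|M|B}(a^{\otimes k}\otimes e)=0 .$$ -/

import Mathlib

open scoped NNReal

namespace FilteredAInfinity

noncomputable section

/-! ### The Novikov ring and completed free modules over it -/

/-- The Novikov ring `Λ_{≥0}`: formal sums `∑ aᵢ T^{lᵢ}` with `aᵢ ∈ ℂ`, `lᵢ ∈ ℝ_{≥0}`, having only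
finitely many nonzero terms below every energy level. -/
def novikovSubring : Subring (HahnSeries ℝ≥0 ℂ) where
  carrier := {f | ∀ c : ℝ≥0, {l | l ≤ c ∧ f.coeff l ≠ 0}.Finite}
  zero_mem' c := by simp
  one_mem' c := by
    refine (Set.finite_singleton (0 : ℝ≥0)).subset ?_
    rintro l ⟨-, h⟩
    by_contra h0
    exact h (by rw [HahnSeries.coeff_one, if_neg (fun h1 => h0 (Set.mem_singleton_iff.2 h1))])
  add_mem' {f g} hf hg c := by
    refine ((hf c).union (hg c)).subset ?_
    rintro l ⟨hl, h⟩
    by_cases h1 : f.coeff l = 0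
    · exact Or.inr ⟨hl, fun h2 => h (by simp [h1, h2])⟩
    · exact Or.inl ⟨hl, h1⟩
  neg_mem' {f} hf c := by
    refine (hf c).subset ?_
    rintro l ⟨hl, h⟩
    exact ⟨hl, fun h2 => h (by simp [h2])⟩
  mul_mem' {f g} hf hg c := by
    refine ((hf c).add (hg c)).subset ?_
    rintro l ⟨hl, h⟩
    obtain ⟨i, hi, j, hj, rfl⟩ := Set.mem_add.1 (HahnSeries.support_mul_subset h)
    exact Set.add_mem_add ⟨le_self_add.trans hl, hi⟩ ⟨le_add_self.trans hl, hj⟩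

/-- The Novikov ring `Λ_{≥0}`. -/
def NovikovRing : Type := ↥novikovSubring

instance : CommRing NovikovRing := inferInstanceAs (CommRing ↥novikovSubring)

/-- The element `T^l` of the Novikov ring. -/
def Tpow (l : ℝ≥0) : NovikovRing :=
  ⟨HahnSeries.single l 1, fun _ => (Set.finite_singleton l).subset fun _ h => by
    by_contra h0
    exact h.2 (HahnSeries.coeff_single_of_ne h0)⟩

/-- The completed tensor product `V ⊗̂ Λ_{≥0}`: formal sums `∑ vᵢ T^{lᵢ}` with `vᵢ ∈ V`,
`lᵢ ∈ ℝ_{≥0}`, having only finitely many nonzero terms below every energy level. This is the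
(completed) free `Λ_{≥0}`-module on a basis of `V`. -/
def novikovModule (V : Type*) [AddCommGroup V] [Module ℂ V] :
    Submodule ↥novikovSubring (HahnModule ℝ≥0 ℂ V) where
  carrier := {x | ∀ c : ℝ≥0, {l | l ≤ c ∧ ((HahnModule.of ℂ).symm x).coeff l ≠ 0}.Finite}
  zero_mem' c := by simp
  add_mem' {x y} hx hy c := by
    refine ((hx c).union (hy c)).subset ?_
    rintro l ⟨hl, h⟩
    by_cases h1 : ((HahnModule.of ℂ).symm x).coeff l = 0
    · exact Or.inr ⟨hl, fun h2 => h (by simp [h1, h2])⟩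
    · exact Or.inl ⟨hl, h1⟩
  smul_mem' f x hx c := by
    refine ((f.2 c).add (hx c)).subset ?_
    rintro l ⟨hl, h⟩
    obtain ⟨i, hi, j, hj, rfl⟩ := Set.mem_vadd.1 (HahnModule.support_smul_subset_vadd_support h)
    exact Set.add_mem_add ⟨le_self_add.trans hl, hi⟩ ⟨le_add_self.trans hl, hj⟩

/-- The `Λ_{≥0}`-module `V ⊗̂ Λ_{≥0}`. -/
def Nov (V : Type*) [AddCommGroup V] [Module ℂ V] : Type _ := ↥(novikovModule V)

instance (V : Type*) [AddCommGroup V] [Module ℂ V] : AddCommGroup (Nov V) :=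
  inferInstanceAs (AddCommGroup ↥(novikovModule V))

instance (V : Type*) [AddCommGroup V] [Module ℂ V] : Module NovikovRing (Nov V) :=
  inferInstanceAs (Module ↥novikovSubring ↥(novikovModule V))

section Modules

variable {V : Type*} [AddCommGroup V] [Module ℂ V]

/-- The coefficient of `T^l`. -/
def Nov.coeff (x : Nov V) (l : ℝ≥0) : V := ((HahnModule.of ℂ).symm x.1).coeff l

/-- The inclusion `V → V ⊗̂ Λ_{≥0}`, `v ↦ v T^0`. -/
def Nov.const (v : V) : Nov V :=
  ⟨HahnModule.of ℂ (HahnSeries.single 0 v), fun _ => (Set.finite_singleton 0).subset fun _ h => by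
    by_contra h0
    exact h.2 (HahnSeries.coeff_single_of_ne h0)⟩

/-- The homogeneous elements of degree `i` of `V ⊗̂ Λ_{≥0}`, for a grading `𝒱` of `V`
(the variable `T` has degree `0`). -/
def homog (𝒱 : ℤ → Submodule ℂ V) (i : ℤ) : Submodule NovikovRing (Nov V) where
  carrier := {x | ∀ l, x.coeff l ∈ 𝒱 i}
  zero_mem' l := (𝒱 i).zero_mem
  add_mem' {x y} hx hy l := (𝒱 i).add_mem (hx l) (hy l)
  smul_mem' f x hx l := by
    have h : (f • x).coeff l = _ := HahnModule.coeff_smul f.1 x.1 l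
    rw [h]
    exact Submodule.sum_mem _ fun p _ => (𝒱 i).smul_mem _ (hx p.2)

/-- The energy filtration: the submodule `T^l X` of a `Λ_{≥0}`-module `X`. -/
def energy (X : Type*) [AddCommGroup X] [Module NovikovRing X] (l : ℝ≥0) :
    Submodule NovikovRing X :=
  LinearMap.range (LinearMap.lsmul NovikovRing X (Tpow l))

/-- `∑ₖ u k = s` in the topology given by the energy filtration: for every `c`, almost all partial
sums agree with `s` modulo `T^c`. -/
def HasEnergySum (u : ℕ → Nov V) (s : Nov V) : Prop :=
  ∀ c : ℝ≥0, ∃ N : ℕ, ∀ n ≥ N, s - ∑ k ∈ Finset.range n, u k ∈ energy (Nov V) c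

end Modules

/-! ### Families of multilinear maps -/

/-- A family of `R`-multilinear maps `X^k → Y`, `k ≥ 0`. The `k`-th map is the restriction of
`toFun` to the lists of length `k`. -/
structure MultiMap (R X Y : Type*) [Ring R] [AddCommGroup X] [Module R X]
    [AddCommGroup Y] [Module R Y] where
  toFun : List X → Y
  map_add : ∀ (p : List X) (x y : X) (q : List X),
    toFun (p ++ (x + y) :: q) = toFun (p ++ x :: q) + toFun (p ++ y :: q)
  map_smul : ∀ (p : List X) (c : R) (x : X) (q : List X),
    toFun (p ++ (c • x) :: q) = c • toFun (p ++ x :: q)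

/-- The linear map which is the member `k = 1` of a family of multilinear maps. -/
def MultiMap.linear {R X Y : Type*} [Ring R] [AddCommGroup X] [Module R X]
    [AddCommGroup Y] [Module R Y] (f : MultiMap R X Y) : X →ₗ[R] Y where
  toFun x := f.toFun [x]
  map_add' x y := f.map_add [] x y []
  map_smul' c x := f.map_smul [] c x []

/-- A family of `R`-multilinear maps `X^{k₁} × M × Z^{k₂} → M`, `k₁, k₂ ≥ 0`. -/
structure BiMultiMap (R X M Z : Type*) [Ring R] [AddCommGroup X] [Module R X]
    [AddCommGroup M] [Module R M] [AddCommGroup Z] [Module R Z] where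
  toFun : List X → M → List Z → M
  map_add_left : ∀ (p : List X) (x x' : X) (q : List X) (y : M) (z : List Z),
    toFun (p ++ (x + x') :: q) y z = toFun (p ++ x :: q) y z + toFun (p ++ x' :: q) y z
  map_smul_left : ∀ (p : List X) (c : R) (x : X) (q : List X) (y : M) (z : List Z),
    toFun (p ++ (c • x) :: q) y z = c • toFun (p ++ x :: q) y z
  map_add_mid : ∀ (x : List X) (y y' : M) (z : List Z),
    toFun x (y + y') z = toFun x y z + toFun x y' z
  map_smul_mid : ∀ (x : List X) (c : R) (y : M) (z : List Z),
    toFun x (c • y) z = c • toFun x y z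
  map_add_right : ∀ (x : List X) (y : M) (p : List Z) (z z' : Z) (q : List Z),
    toFun x y (p ++ (z + z') :: q) = toFun x y (p ++ z :: q) + toFun x y (p ++ z' :: q)
  map_smul_right : ∀ (x : List X) (y : M) (p : List Z) (c : R) (z : Z) (q : List Z),
    toFun x y (p ++ (c • z) :: q) = c • toFun x y (p ++ z :: q)

/-- The linear map `m^{0|1|0} : M → M`. -/
def BiMultiMap.diff {R X M Z : Type*} [CommRing R] [AddCommGroup X] [Module R X]
    [AddCommGroup M] [Module R M] [AddCommGroup Z] [Module R Z] (n : BiMultiMap R X M Z) :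
    M →ₗ[R] M where
  toFun y := n.toFun [] y []
  map_add' y y' := n.map_add_mid [] y y' []
  map_smul' c y := n.map_smul_mid [] c y []

/-- The linear map `a ↦ m^{1|1|0}(a ⊗ e)`. -/
def BiMultiMap.mulRight {R X M Z : Type*} [CommRing R] [AddCommGroup X] [Module R X]
    [AddCommGroup M] [Module R M] [AddCommGroup Z] [Module R Z] (n : BiMultiMap R X M Z) (e : M) :
    X →ₗ[R] M where
  toFun x := n.toFun [x] e []
  map_add' x x' := n.map_add_left [] x x' [] e []
  map_smul' c x := n.map_smul_left [] c x [] e []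

/-- The sign `(-1)^n` as an integer. -/
def sgn (n : ℤ) : ℤ := ((Int.negOnePow n : ℤˣ) : ℤ)

/-- `♣(x, i) = i + ∑_{j < i} deg x_j`, for a list of inputs `x` of degrees `d`. -/
def club (d : List ℤ) (i : ℕ) : ℤ := i + (d.take i).sum

/-- `∑_{i, j} (-1)^{♣(x, i)} f(x₁, …, xᵢ, m(xᵢ₊₁, …, xᵢ₊ⱼ), xᵢ₊ⱼ₊₁, …, xₖ)`, where `x` is a list
of inputs of degrees `d`; the terms with `j = 0` insert the curvature `m()`. -/
def insertSum {X Y : Type*} [AddCommGroup Y] (m : List X → X) (f : List X → Y)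
    (d : List ℤ) (x : List X) : Y :=
  ∑ i ∈ Finset.range (x.length + 1), ∑ j ∈ Finset.range (x.length + 1 - i),
    sgn (club d i) • f (x.take i ++ m ((x.drop i).take j) :: x.drop (i + j))

/-- The list `x` consists of homogeneous elements whose degrees are listed in `d`. -/
def HasDegrees {V : Type*} [AddCommGroup V] [Module ℂ V] (𝒱 : ℤ → Submodule ℂ V)
    (x : List (Nov V)) (d : List ℤ) : Prop :=
  List.Forall₂ (fun y i => y ∈ homog 𝒱 i) x d

/-- The `k`-ary part of `F` has degree `s - k` for all `k`. -/
def HasShift {V W : Type*} [AddCommGroup V] [Module ℂ V] [AddCommGroup W] [Module ℂ W]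
    (𝒱 : ℤ → Submodule ℂ V) (𝒲 : ℤ → Submodule ℂ W) (s : ℤ)
    (F : MultiMap NovikovRing (Nov V) (Nov W)) : Prop :=
  ∀ (x : List (Nov V)) (d : List ℤ), HasDegrees 𝒱 x d →
    F.toFun x ∈ homog 𝒲 (d.sum + s - x.length)

/-- The `k`-ary part of a family of maps `V^k → W` over `ℂ` has degree `s - k` for all `k`. -/
def HasShiftC {V W : Type*} [AddCommGroup V] [Module ℂ V] [AddCommGroup W] [Module ℂ W]
    (𝒱 : ℤ → Submodule ℂ V) (𝒲 : ℤ → Submodule ℂ W) (s : ℤ) (F : MultiMap ℂ V W) : Prop :=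
  ∀ (x : List V) (d : List ℤ), List.Forall₂ (fun y i => y ∈ 𝒱 i) x d →
    F.toFun x ∈ 𝒲 (d.sum + s - x.length)

/-! ### Filtered `A_∞` algebras, homomorphisms and homotopies -/

/-- A filtered `A_∞` algebra structure on the completed free graded module `V ⊗̂ Λ_{≥0}`. -/
structure AInfAlgebra {V : Type*} [AddCommGroup V] [Module ℂ V] (𝒱 : ℤ → Submodule ℂ V) where
  graded : DirectSum.IsInternal 𝒱
  m : MultiMap NovikovRing (Nov V) (Nov V)
  degree : HasShift 𝒱 𝒱 2 m
  curvature_pos : ∃ l : ℝ≥0, 0 < l ∧ m.toFun [] ∈ energy (Nov V) l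
  relation : ∀ (x : List (Nov V)) (d : List ℤ), HasDegrees 𝒱 x d →
    insertSum m.toFun m.toFun d x = 0

/-- An `A_∞` algebra is tautologically unobstructed if `m^0 = 0`. -/
def AInfAlgebra.TautUnobstructed {V : Type*} [AddCommGroup V] [Module ℂ V]
    {𝒱 : ℤ → Submodule ℂ V} (A : AInfAlgebra 𝒱) : Prop :=
  A.m.toFun [] = 0

/-- A deforming cochain: an element of `A^1` of positive valuation. -/
def AInfAlgebra.IsDeforming {V : Type*} [AddCommGroup V] [Module ℂ V]
    {𝒱 : ℤ → Submodule ℂ V} (_A : AInfAlgebra 𝒱) (a : Nov V) : Prop :=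
  a ∈ homog 𝒱 1 ∧ ∃ l : ℝ≥0, 0 < l ∧ a ∈ energy (Nov V) l

/-- A bounding cochain: a deforming cochain `a` such that
`m^0_{(A,a)} = ∑ₖ m^k(a, …, a)` is zero. -/
def AInfAlgebra.IsBounding {V : Type*} [AddCommGroup V] [Module ℂ V]
    {𝒱 : ℤ → Submodule ℂ V} (A : AInfAlgebra 𝒱) (a : Nov V) : Prop :=
  A.IsDeforming a ∧ HasEnergySum (fun k => A.m.toFun (List.replicate k a)) 0

/-- An anti-commutative differential graded algebra, as an `A_∞` algebra: `m^k = 0` for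
`k ≠ 1, 2`, and the product `x · y = (-1)^{deg x} m^2(x, y)` satisfies
`x · y = (-1)^{deg x deg y} y · x`. -/
structure AInfAlgebra.IsAnticommutativeDGA {V : Type*} [AddCommGroup V] [Module ℂ V]
    {𝒱 : ℤ → Submodule ℂ V} (A : AInfAlgebra 𝒱) : Prop where
  eq_zero : ∀ x : List (Nov V), x.length ≠ 1 → x.length ≠ 2 → A.m.toFun x = 0
  comm : ∀ (i j : ℤ) (x y : Nov V), x ∈ homog 𝒱 i → y ∈ homog 𝒱 j →
    sgn i • A.m.toFun [x, y] = sgn (i * j) • sgn j • A.m.toFun [y, x]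

/-- The sum of `F([f(x_{(1)}), …, f(x_{(r)})])` over all ways to cut the list `x` into consecutive
nonempty blocks `x_{(1)}, …, x_{(r)}`. -/
def cutSum {X Y Z : Type*} [AddCommGroup Z] (f : List X → Y) (F : List Y → Z) (x : List X) : Z :=
  ∑ c : Composition x.length, F ((x.splitWrtComposition c).map f)

section Homs

variable {V W : Type*} [AddCommGroup V] [Module ℂ V] [AddCommGroup W] [Module ℂ W]
  {𝒱 : ℤ → Submodule ℂ V} {𝒲 : ℤ → Submodule ℂ W}

/-- A filtered `A_∞` homomorphism `f^k : A^{⊗ k} → B`, `k ≥ 1` (there is no term `f^0`). -/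
structure AInfHom (A : AInfAlgebra 𝒱) (B : AInfAlgebra 𝒲) where
  f : MultiMap NovikovRing (Nov V) (Nov W)
  degree : HasShift 𝒱 𝒲 1 f
  map_nil : f.toFun [] = 0
  relation : ∀ (x : List (Nov V)) (d : List ℤ), HasDegrees 𝒱 x d →
    insertSum A.m.toFun f.toFun d x = cutSum f.toFun B.m.toFun x

/-- Two families `f, f'` of maps `A^{⊗ k} → B` are homotopic: there are maps
`h^k : A^{⊗ k} → B`, `k ≥ 1`, of degree `-k`, with
`f - f' = ∑ ± m_B(f, …, f, h, f', …, f') + ∑ ± h(id, …, id, m_A, id, …, id)`. -/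
def Homotopic (A : AInfAlgebra 𝒱) (B : AInfAlgebra 𝒲) (f f' : List (Nov V) → Nov W) : Prop :=
  ∃ h : MultiMap NovikovRing (Nov V) (Nov W), HasShift 𝒱 𝒲 0 h ∧ h.toFun [] = 0 ∧
    ∀ (x : List (Nov V)) (d : List ℤ), HasDegrees 𝒱 x d →
      f x - f' x =
        (∑ i ∈ Finset.range (x.length + 1), ∑ j ∈ Finset.range (x.length + 1 - i),
          sgn (club d i) •
            cutSum f (fun p => cutSum f'
              (fun q => B.m.toFun (p ++ h.toFun ((x.drop i).take j) :: q))
              (x.drop (i + j))) (x.take i))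
        + insertSum A.m.toFun h.toFun d x

end Homs

/-- The composition of two `A_∞` homomorphisms, as a family of maps. -/
def AInfHom.comp {U V W : Type*} [AddCommGroup U] [Module ℂ U] [AddCommGroup V] [Module ℂ V]
    [AddCommGroup W] [Module ℂ W] {𝒰 : ℤ → Submodule ℂ U} {𝒱 : ℤ → Submodule ℂ V}
    {𝒲 : ℤ → Submodule ℂ W} {A : AInfAlgebra 𝒰} {B : AInfAlgebra 𝒱} {C : AInfAlgebra 𝒲}
    (g : AInfHom B C) (f : AInfHom A B) : List (Nov U) → Nov W :=
  fun x => cutSum f.f.toFun g.f.toFun x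

/-- The identity homomorphism, as a family of maps: `id^1 = id` and `id^k = 0` for `k ≠ 1`. -/
def idFamily {X : Type*} [Zero X] : List X → X
  | [x] => x
  | _ => 0

/-- `g` is a homotopy inverse of the `A_∞` homomorphism `f`. -/
def AInfHom.IsHomotopyInverse {V W : Type*} [AddCommGroup V] [Module ℂ V] [AddCommGroup W]
    [Module ℂ W] {𝒱 : ℤ → Submodule ℂ V} {𝒲 : ℤ → Submodule ℂ W} {A : AInfAlgebra 𝒱}
    {B : AInfAlgebra 𝒲} (g : AInfHom B A) (f : AInfHom A B) : Prop :=
  Homotopic A A (g.comp f) idFamily ∧ Homotopic B B (f.comp g) idFamily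

/-! ### Gapped structures -/

/-- A finitely generated commutative monoid with an energy `ω : G → ℝ_{≥0}` that vanishes only
at `0`. -/
structure EnergyMonoid (G : Type*) [AddCommMonoid G] where
  fg : AddMonoid.FG G
  ω : G →+ ℝ≥0
  eq_zero : ∀ β, ω β = 0 → β = 0

/-- `F^k = ∑_{β ∈ G} T^{ω(β)} F^{k,β}`, where the maps `F^{k,β} = μ β` are induced by `ℂ`-linear
maps `V^{⊗ k} → W` (so they preserve energies). As `F^k` is `Λ_{≥0}`-multilinear it suffices
to say this on `V`, where the coefficient of `T^l` is the finite sum of `F^{k,β}` over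
`ω(β) = l`. -/
def IsGapDecomposition {V W G : Type*} [AddCommGroup V] [Module ℂ V] [AddCommGroup W] [Module ℂ W]
    [AddCommMonoid G] (E : EnergyMonoid G) (F : MultiMap NovikovRing (Nov V) (Nov W))
    (μ : G → MultiMap ℂ V W) : Prop :=
  ∀ (v : List V) (l : ℝ≥0),
    (F.toFun (v.map Nov.const)).coeff l = ∑ᶠ (β : G) (_ : E.ω β = l), (μ β).toFun v

/-- The `A_∞` algebra `A` is `G`-gapped. -/
def AInfAlgebra.IsGapped {V G : Type*} [AddCommGroup V] [Module ℂ V] {𝒱 : ℤ → Submodule ℂ V}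
    [AddCommMonoid G] (A : AInfAlgebra 𝒱) (E : EnergyMonoid G) : Prop :=
  ∃ μ : G → MultiMap ℂ V V, (∀ β, HasShiftC 𝒱 𝒱 2 (μ β)) ∧ IsGapDecomposition E A.m μ

/-- The `A_∞` homomorphism `f` from a `G`-gapped algebra to an `H`-gapped algebra is gapped. -/
def AInfHom.IsGapped {V W G H : Type*} [AddCommGroup V] [Module ℂ V] [AddCommGroup W] [Module ℂ W]
    [AddCommMonoid G] [AddCommMonoid H] {𝒱 : ℤ → Submodule ℂ V} {𝒲 : ℤ → Submodule ℂ W}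
    {A : AInfAlgebra 𝒱} {B : AInfAlgebra 𝒲} (f : AInfHom A B) (E : EnergyMonoid G)
    (E' : EnergyMonoid H) : Prop :=
  (∃ φ : G →+ H, ∀ β, E'.ω (φ β) = E.ω β) ∧
    ∃ μ : H → MultiMap ℂ V W, (∀ β, HasShiftC 𝒱 𝒲 1 (μ β)) ∧ IsGapDecomposition E' f.f μ

/-! ### Bimodules -/

section Bimodules

variable {U V W : Type*} [AddCommGroup U] [Module ℂ U] [AddCommGroup V] [Module ℂ V]
  [AddCommGroup W] [Module ℂ W] {𝒰 : ℤ → Submodule ℂ U} {𝒱 : ℤ → Submodule ℂ V}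
  {𝒲 : ℤ → Submodule ℂ W}

/-- A filtered `(A, B)`-bimodule structure on the completed free graded module `W ⊗̂ Λ_{≥0}`, with
products `m^{k₁|1|k₂}` of degree `1 - k₁ - k₂`. The three groups of terms in the relation apply
first `m_A`, `m_{A|M|B}` and `m_B` respectively; the sign of each term is `(-1)^♣` for the inputs
to the left of the operation applied first. -/
structure AInfBimodule (A : AInfAlgebra 𝒰) (B : AInfAlgebra 𝒱) (𝒲 : ℤ → Submodule ℂ W) where
  graded : DirectSum.IsInternal 𝒲
  n : BiMultiMap NovikovRing (Nov U) (Nov W) (Nov V)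
  degree : ∀ (x : List (Nov U)) (d : List ℤ) (y : Nov W) (p : ℤ) (z : List (Nov V)) (d' : List ℤ),
    HasDegrees 𝒰 x d → y ∈ homog 𝒲 p → HasDegrees 𝒱 z d' →
      n.toFun x y z ∈ homog 𝒲 (d.sum + p + d'.sum + 1 - x.length - z.length)
  relation : ∀ (x : List (Nov U)) (d : List ℤ) (y : Nov W) (p : ℤ) (z : List (Nov V))
    (d' : List ℤ), HasDegrees 𝒰 x d → y ∈ homog 𝒲 p → HasDegrees 𝒱 z d' →
      insertSum A.m.toFun (fun x' => n.toFun x' y z) d x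
      + (∑ i ∈ Finset.range (x.length + 1), ∑ j ∈ Finset.range (z.length + 1),
          sgn (club d i) •
            n.toFun (x.take i) (n.toFun (x.drop i) y (z.take j)) (z.drop j))
      + sgn (club d x.length + (p + 1)) •
          insertSum B.m.toFun (fun z' => n.toFun x y z') d' z = 0

/-- The bimodule `M` over the `G_A`- and `G_B`-gapped algebras `A` and `B` is `G`-gapped. -/
def AInfBimodule.IsGapped {GA GB G : Type*} [AddCommMonoid GA] [AddCommMonoid GB]
    [AddCommMonoid G] {A : AInfAlgebra 𝒰} {B : AInfAlgebra 𝒱} (M : AInfBimodule A B 𝒲)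
    (EA : EnergyMonoid GA) (EB : EnergyMonoid GB) (E : EnergyMonoid G) : Prop :=
  (∃ φ : GA →+ G, ∀ β, E.ω (φ β) = EA.ω β) ∧ (∃ φ : GB →+ G, ∀ β, E.ω (φ β) = EB.ω β) ∧
    ∃ ν : G → BiMultiMap ℂ U W V,
      (∀ β (x : List U) (d : List ℤ) (y : W) (p : ℤ) (z : List V) (d' : List ℤ),
        List.Forall₂ (fun x i => x ∈ 𝒰 i) x d → y ∈ 𝒲 p → List.Forall₂ (fun z i => z ∈ 𝒱 i) z d' →
          (ν β).toFun x y z ∈ 𝒲 (d.sum + p + d'.sum + 1 - x.length - z.length)) ∧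
      ∀ (x : List U) (y : W) (z : List V) (l : ℝ≥0),
        (M.n.toFun (x.map Nov.const) (Nov.const y) (z.map Nov.const)).coeff l =
          ∑ᶠ (β : G) (_ : E.ω β = l), (ν β).toFun x y z

/-- `m^{0|1|0}_{(A,a)|M|B}(e) = s`, where the deformed differential is
`m^{0|1|0}_{(A,a)|M|B}(e) = ∑ₖ m^{k|1|0}(a, …, a, e)`. -/
def AInfBimodule.DeformedDiffEq {A : AInfAlgebra 𝒰} {B : AInfAlgebra 𝒱} (M : AInfBimodule A B 𝒲)
    (a : Nov U) (e s : Nov W) : Prop :=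
  HasEnergySum (fun k => M.n.toFun (List.replicate k a) e []) s

/-! ### Cohomology -/

/-- Cocycles of degree `i` of the quotient complex `P/Q`, as elements of `P`: homogeneous `x ∈ P`
with `d x ∈ Q`. -/
def cocycles (𝒱 : ℤ → Submodule ℂ V) (d : Nov V →ₗ[NovikovRing] Nov V)
    (P Q : Submodule NovikovRing (Nov V)) (i : ℤ) : Submodule NovikovRing (Nov V) :=
  homog 𝒱 i ⊓ P ⊓ Q.comap d

/-- Coboundaries of degree `i` of the quotient complex `P/Q`, as elements of `P`:
`d(P^{i-1}) + Q^i`. -/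
def coboundaries (𝒱 : ℤ → Submodule ℂ V) (d : Nov V →ₗ[NovikovRing] Nov V)
    (P Q : Submodule NovikovRing (Nov V)) (i : ℤ) : Submodule NovikovRing (Nov V) :=
  (homog 𝒱 (i - 1) ⊓ P).map d ⊔ (homog 𝒱 i ⊓ Q)

/-- The cohomology `H^i(P/Q)` with respect to the differential `d` induced on the quotient of two
graded submodules `Q ⊆ P`. -/
abbrev Cohomology (𝒱 : ℤ → Submodule ℂ V) (d : Nov V →ₗ[NovikovRing] Nov V)
    (P Q : Submodule NovikovRing (Nov V)) (i : ℤ) : Type _ :=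
  ↥(cocycles 𝒱 d P Q i) ⧸ (coboundaries 𝒱 d P Q i).submoduleOf (cocycles 𝒱 d P Q i)

/-- The maps `m^{k|1|0} : A^{⊗ k} ⊗ M → M` all have image in `T^l M`. -/
def AInfBimodule.LeftProductsIn {A : AInfAlgebra 𝒰} {B : AInfAlgebra 𝒱} (M : AInfBimodule A B 𝒲)
    (l : ℝ≥0) : Prop :=
  ∀ (x : List (Nov U)) (y : Nov W), M.n.toFun x y [] ∈ energy (Nov W) l

theorem map_mem_energy {X Y : Type*} [AddCommGroup X] [Module NovikovRing X] [AddCommGroup Y]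
    [Module NovikovRing Y] (f : X →ₗ[NovikovRing] Y) {l : ℝ≥0} {x : X} (hx : x ∈ energy X l) :
    f x ∈ energy Y l := by
  obtain ⟨y, rfl⟩ := hx
  exact ⟨f y, by simp⟩

theorem AInfBimodule.leibniz {A : AInfAlgebra 𝒰} {B : AInfAlgebra 𝒱} (M : AInfBimodule A B 𝒲)
    (hA : A.TautUnobstructed) (hB : B.TautUnobstructed) {i p : ℤ} {b : Nov U} {e : Nov W}
    (hb : b ∈ homog 𝒰 i) (he : e ∈ homog 𝒲 p) :
    M.n.mulRight e (A.m.linear b) + M.n.diff (M.n.mulRight e b)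
      + sgn (1 + i) • M.n.mulRight (M.n.diff e) b = 0 := by
  have h := M.relation [b] [i] e p [] [] (.cons hb .nil) he .nil
  have hA' : A.m.toFun [] = 0 := hA
  have hB' : B.m.toFun [] = 0 := hB
  have h1 : M.n.toFun [0, b] e [] = 0 := by
    simpa using M.n.map_smul_left [] 0 0 [b] e []
  have h2 : M.n.toFun [b, 0] e [] = 0 := by
    simpa using M.n.map_smul_left [b] 0 0 [] e []
  have h3 : M.n.toFun [b] e [0] = 0 := by
    simpa using M.n.map_smul_right [b] e [] 0 0 []
  simpa [insertSum, Finset.sum_range_succ, club, sgn, hA', hB', h1, h2, h3, ← add_assoc,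
    MultiMap.linear, BiMultiMap.diff, BiMultiMap.mulRight] using h

/-- Multiplication by `e ∈ M^0` with `m^{0|1|0}(e) ∈ T^{l₁} M`, i.e. by a cocycle of `M / T^{l₁} M`,
as a map on cohomology: `H^1(A) → H^1(T^{l₀} M / T^{l₁} M)`, `[a] ↦ [m^{1|1|0}(a ⊗ e)]`. -/
def AInfBimodule.mulOnH1 {A : AInfAlgebra 𝒰} {B : AInfAlgebra 𝒱} (M : AInfBimodule A B 𝒲)
    (hA : A.TautUnobstructed) (hB : B.TautUnobstructed) {l₀ l₁ : ℝ≥0} (hM : M.LeftProductsIn l₀)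
    (e : Nov W) (he : e ∈ homog 𝒲 0) (hde : M.n.diff e ∈ energy (Nov W) l₁) :
    Cohomology 𝒰 A.m.linear ⊤ ⊥ 1 →ₗ[NovikovRing]
      Cohomology 𝒲 M.n.diff (energy (Nov W) l₀) (energy (Nov W) l₁) 1 :=
  have hdeg : ∀ (i p : ℤ) (y : Nov W) (b : Nov U), y ∈ homog 𝒲 p → b ∈ homog 𝒰 i →
      M.n.mulRight y b ∈ homog 𝒲 (i + p) := fun i p y b hy hb => by
    have h := M.degree [b] [i] y p [] [] (.cons hb .nil) hy .nil
    simpa [BiMultiMap.mulRight] using h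
  have hen : ∀ b : Nov U, M.n.mulRight (M.n.diff e) b ∈ energy (Nov W) l₁ := fun b => by
    let g : Nov W →ₗ[NovikovRing] Nov W :=
      { toFun := fun y => M.n.toFun [b] y []
        map_add' := fun y y' => M.n.map_add_mid [b] y y' []
        map_smul' := fun c y => M.n.map_smul_mid [b] c y [] }
    exact map_mem_energy g hde
  have hde' : M.n.diff e ∈ homog 𝒲 1 := by
    simpa [BiMultiMap.diff] using M.degree [] [] e 0 [] [] .nil he .nil
  Submodule.mapQ _ _
    ((M.n.mulRight e).restrict
      (p := cocycles 𝒰 A.m.linear ⊤ ⊥ 1)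
      (q := cocycles 𝒲 M.n.diff (energy (Nov W) l₀) (energy (Nov W) l₁) 1)
      (by
        rintro a ⟨⟨ha, -⟩, hda⟩
        refine ⟨⟨by simpa using hdeg 1 0 e a he ha, hM [a] e⟩, ?_⟩
        have h := M.leibniz hA hB ha he
        have hda' : A.m.linear a = 0 := hda
        rw [hda', map_zero, zero_add] at h
        show M.n.diff (M.n.mulRight e a) ∈ energy (Nov W) l₁
        rw [eq_neg_of_add_eq_zero_left h]
        exact neg_mem (zsmul_mem (hen a) _)))
    (by
      rintro ⟨a, ha⟩ hab
      obtain ⟨a', ⟨b, ⟨hb, -⟩, rfl⟩, z, ⟨-, hz⟩, hab⟩ := Submodule.mem_sup.1 hab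
      have hz' : z = 0 := hz
      have hab' : A.m.linear b = a := by simpa [hz'] using hab
      have hb' : b ∈ homog 𝒰 0 := by simpa using hb
      have h := M.leibniz hA hB hb' he
      rw [add_assoc, hab'] at h
      refine Submodule.mem_comap.2 (Submodule.mem_sup.2
        ⟨M.n.diff (-(M.n.mulRight e b)), ⟨_, ⟨?_, neg_mem (hM [b] e)⟩, rfl⟩,
          -(sgn (1 + 0) • M.n.mulRight (M.n.diff e) b), ⟨?_, neg_mem (zsmul_mem (hen b) _)⟩, ?_⟩)
      · exact neg_mem (hdeg 0 0 e b he hb')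
      · exact neg_mem (zsmul_mem (by simpa using hdeg 0 1 _ b hde' hb') _)
      · rw [map_neg, ← neg_add]
        exact (eq_neg_of_add_eq_zero_left h).symm)

end Bimodules

end

end FilteredAInfinity

open FilteredAInfinity

/-!
The equation for `(a, e)` is solved order by order in the energy, with a uniform gain of
`δ = l₁ - l₀` in each step.

In an anti-commutative algebra `A'` elements of degree `1` square to zero, so every cocycle `x` of
degree `1` and positive energy is a solution of the Maurer–Cartan equation. Its push-forward
`a = ∑ₖ gᵏ(x, …, x)` along the `A_∞` homomorphism `g : A' → A` is a bounding cochain of `A`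
(`AInfHom.hasSum_toFun_replicate_pushforward`). Hence bounding cochains may be modified by
arbitrary cocycles of `A'`, without any obstruction in `A`.

Let `D_a = ∑ₖ m^{k|1|0}(a, …, a, ·)` be the deformed differential of `M`. It squares to zero if
`a` is a bounding cochain (`AInfBimodule.deformedDiff_deformedDiff`). Suppose that `x ∈ T^δ A'`
and `e ≡ e₀` satisfy `D_a e = T^s y` with `y ∈ T^{l₀} M` and `s ≥ δ`; for `x = 0`, `e = e₀` this
holds with `s = δ`. As `M` has no torsion, `D_a y = 0`, and as all terms of `D_a y` except
`m^{0|1|0}(y)` lie in `T^{l₀ + δ} M = T^{l₁} M`, the element `y` is a cocycle of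
`T^{l₀} M / T^{l₁} M`. By surjectivity, and because `g ∘ f` is homotopic to the identity,
`y ≡ m^{1|1|0}(g¹(c), e₀) + m^{0|1|0}(z)` modulo `T^{l₁} M`, for a cocycle `c` of `A'` and some
`z ∈ T^{l₀} M` (`exists_cocycle_of_surjective`). Replacing `x` by `x - T^s c` and `e` by
`e - T^s z` changes `D_a e` by `-T^s y` up to terms in `T^{s + l₁} M`
(`AInfBimodule.deformedDiff_update`), so the new obstruction is of order `s + δ`
(`exists_correction`). The successive corrections converge in the energy topology, in which all
operations are continuous, and the limit solves the equation.

Infinite sums are handled as `HasSum` for the topology defined by the energy filtration. A family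
is summable if for each `c` only finitely many members lie outside `T^c`
(`summable_of_finite_notMem_energy`), and this allows all the rearrangements needed.
-/

open Filter Topology

namespace FilteredAInfinity

noncomputable section

/-! ### Coefficients and the energy filtration -/

section Energy

variable {V : Type*} [AddCommGroup V] [Module ℂ V]

theorem Nov.ext {x y : Nov V} (h : ∀ l, x.coeff l = y.coeff l) : x = y :=
  Subtype.ext (HahnModule.ext _ _ (funext h))

@[simp] theorem Nov.coeff_sub (x y : Nov V) (l : ℝ≥0) :
    (x - y).coeff l = x.coeff l - y.coeff l := rfl

theorem Nov.finite_support (x : Nov V) (c : ℝ≥0) : {l | l ≤ c ∧ x.coeff l ≠ 0}.Finite := x.2 c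

/-- The coefficient of `T^l`, as an additive map. -/
def Nov.coeffHom (l : ℝ≥0) : Nov V →+ V where
  toFun x := x.coeff l
  map_zero' := rfl
  map_add' _ _ := rfl

theorem Nov.coeff_sum {ι : Type*} (S : Finset ι) (u : ι → Nov V) (l : ℝ≥0) :
    (∑ i ∈ S, u i).coeff l = ∑ i ∈ S, (u i).coeff l :=
  map_sum (Nov.coeffHom l) u S

theorem isPWO_of_finite_below {s : Set ℝ≥0} (h : ∀ c, {l | l ≤ c ∧ l ∈ s}.Finite) : s.IsPWO := by
  rw [Set.isPWO_iff_isWF, Set.isWF_iff_no_descending_seq]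
  intro f hf hs
  refine Set.infinite_of_injective_forall_mem hf.injective (fun n => ?_) (h (f 0))
  exact ⟨hf.antitone (Nat.zero_le n), hs n⟩

/-- The element of `V ⊗̂ Λ_{≥0}` with given coefficients. -/
def Nov.ofCoeff (φ : ℝ≥0 → V) (h : ∀ c, {l | l ≤ c ∧ φ l ≠ 0}.Finite) : Nov V :=
  ⟨HahnModule.of ℂ ⟨φ, isPWO_of_finite_below h⟩, h⟩

@[simp] theorem Nov.coeff_ofCoeff (φ : ℝ≥0 → V) (h : ∀ c, {l | l ≤ c ∧ φ l ≠ 0}.Finite)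
    (l : ℝ≥0) : (Nov.ofCoeff φ h).coeff l = φ l := rfl

theorem coeff_Tpow_smul_add (a l : ℝ≥0) (x : Nov V) :
    (Tpow a • x).coeff (a + l) = x.coeff l :=
  (HahnModule.coeff_single_smul_vadd (r := (1 : ℂ)) (x := x.1) (a := l) (b := a)).trans
    (one_smul ℂ _)

theorem coeff_Tpow_smul_of_lt {a l : ℝ≥0} (h : l < a) (x : Nov V) :
    (Tpow a • x).coeff l = 0 := by
  by_contra h0
  obtain ⟨i, hi, j, hj, rfl⟩ := Set.mem_vadd.1
    (HahnModule.support_smul_subset_vadd_support (x := (Tpow a).1) (y := x.1) h0)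
  have : i = a := by
    by_contra hia
    exact hi (HahnSeries.coeff_single_of_ne hia)
  subst this
  exact absurd h (not_lt.2 (le_self_add : i ≤ i + j))

theorem Tpow_add (a b : ℝ≥0) : Tpow (a + b) = Tpow a * Tpow b :=
  Subtype.ext (by
    have := HahnSeries.single_mul_single (a := a) (b := b) (r := (1 : ℂ)) (s := 1)
    rw [mul_one] at this
    exact this.symm)

theorem Tpow_smul_injective (a : ℝ≥0) : Function.Injective (fun x : Nov V => Tpow a • x) := by
  intro x y h
  refine Nov.ext fun l => ?_
  rw [← coeff_Tpow_smul_add a l x, ← coeff_Tpow_smul_add a l y]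
  exact congrArg (fun z => Nov.coeff z (a + l)) h

theorem mem_energy_iff {l : ℝ≥0} {x : Nov V} :
    x ∈ energy (Nov V) l ↔ ∀ l' < l, x.coeff l' = 0 := by
  constructor
  · rintro ⟨y, rfl⟩ l' h
    exact coeff_Tpow_smul_of_lt h y
  · intro h
    refine ⟨Nov.ofCoeff (fun l' => x.coeff (l + l')) fun c => ?_, ?_⟩
    · refine ((x.finite_support (l + c)).preimage (add_right_injective l).injOn).subset ?_
      rintro l' ⟨h1, h2⟩
      exact ⟨add_le_add_right h1 l, h2⟩
    · refine Nov.ext fun l' => ?_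
      change Nov.coeff (Tpow l • Nov.ofCoeff _ _) l' = _
      rcases lt_or_ge l' l with h1 | h1
      · rw [coeff_Tpow_smul_of_lt h1, h l' h1]
      · obtain ⟨d, rfl⟩ := exists_add_of_le h1
        rw [coeff_Tpow_smul_add, Nov.coeff_ofCoeff]

theorem mem_energy_iff_exists {X : Type*} [AddCommGroup X] [Module NovikovRing X] {l : ℝ≥0}
    {x : X} : x ∈ energy X l ↔ ∃ y, x = Tpow l • y :=
  ⟨fun ⟨y, h⟩ => ⟨y, h.symm⟩, fun ⟨y, h⟩ => ⟨y, h.symm⟩⟩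

theorem energy_anti {a b : ℝ≥0} (h : a ≤ b) : energy (Nov V) b ≤ energy (Nov V) a :=
  fun _ hx => mem_energy_iff.2 fun l' hl' => mem_energy_iff.1 hx l' (hl'.trans_le h)

theorem mem_energy_zero (x : Nov V) : x ∈ energy (Nov V) 0 :=
  mem_energy_iff.2 fun _ h => absurd h not_lt_zero

theorem Tpow_smul_mem_energy (b : ℝ≥0) {a : ℝ≥0} {x : Nov V} (hx : x ∈ energy (Nov V) a) :
    Tpow b • x ∈ energy (Nov V) (b + a) := by
  obtain ⟨y, rfl⟩ := mem_energy_iff_exists.1 hx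
  exact mem_energy_iff_exists.2 ⟨y, by rw [Tpow_add, mul_smul]⟩

theorem eq_zero_of_forall_mem_energy {x : Nov V} (h : ∀ c, x ∈ energy (Nov V) c) : x = 0 :=
  Nov.ext fun l => mem_energy_iff.1 (h (l + 1)) l (lt_add_one l)

theorem eq_zero_of_forall_mem_energy_nsmul {δ : ℝ≥0} (hδ : 0 < δ) {x : Nov V}
    (h : ∀ n : ℕ, x ∈ energy (Nov V) (n • δ)) : x = 0 :=
  eq_zero_of_forall_mem_energy fun c => by
    obtain ⟨n, hn⟩ := Archimedean.arch c hδ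
    exact energy_anti hn (h n)

theorem mem_homog_of_Tpow_smul_mem {𝒱 : ℤ → Submodule ℂ V} {i : ℤ} {a : ℝ≥0} {x : Nov V}
    (h : Tpow a • x ∈ homog 𝒱 i) : x ∈ homog 𝒱 i := fun l => by
  rw [← coeff_Tpow_smul_add a l x]
  exact h _

/-! ### Infinite sums in the energy topology -/

/-- The submodules `T^c (V ⊗̂ Λ_{≥0})` as a basis of neighbourhoods of zero. -/
@[reducible] def energyBasis (V : Type*) [AddCommGroup V] [Module ℂ V] :
    AddGroupFilterBasis (Nov V) :=
  addGroupFilterBasisOfComm (Set.range fun c => (energy (Nov V) c : Set (Nov V)))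
    (Set.range_nonempty _)
    (by
      rintro _ _ ⟨a, rfl⟩ ⟨b, rfl⟩
      exact ⟨_, ⟨max a b, rfl⟩, fun x hx =>
        ⟨energy_anti (le_max_left a b) hx, energy_anti (le_max_right a b) hx⟩⟩)
    (by
      rintro _ ⟨a, rfl⟩
      exact (energy (Nov V) a).zero_mem)
    (by
      rintro _ ⟨a, rfl⟩
      refine ⟨_, ⟨a, rfl⟩, ?_⟩
      rintro _ ⟨x, hx, y, hy, rfl⟩
      exact (energy (Nov V) a).add_mem hx hy)
    (by
      rintro _ ⟨a, rfl⟩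
      exact ⟨_, ⟨a, rfl⟩, fun x hx => (energy (Nov V) a).neg_mem hx⟩)

/-- The topology of `V ⊗̂ Λ_{≥0}` given by the energy filtration. -/
instance : TopologicalSpace (Nov V) := (energyBasis V).topology

instance : IsTopologicalAddGroup (Nov V) := (energyBasis V).isTopologicalAddGroup

theorem hasBasis_nhds_zero :
    (𝓝 (0 : Nov V)).HasBasis (fun _ : ℝ≥0 => True) fun c => (energy (Nov V) c : Set (Nov V)) :=
  ⟨fun t => by
    rw [(energyBasis V).nhds_zero_hasBasis.mem_iff]
    constructor
    · rintro ⟨_, ⟨c, rfl⟩, h⟩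
      exact ⟨c, trivial, h⟩
    · rintro ⟨c, -, h⟩
      exact ⟨_, ⟨c, rfl⟩, h⟩⟩

theorem tendsto_iff_eventually_mem_energy {ι : Type*} {F : Filter ι} {u : ι → Nov V} {s : Nov V} :
    Tendsto u F (𝓝 s) ↔ ∀ c, ∀ᶠ i in F, s - u i ∈ energy (Nov V) c := by
  rw [← tendsto_sub_nhds_zero_iff, hasBasis_nhds_zero.tendsto_right_iff]
  simp only [true_imp_iff, SetLike.mem_coe]
  refine forall_congr' fun c => eventually_congr (.of_forall fun i => ?_)
  rw [← neg_sub, Submodule.neg_mem_iff]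

instance : T2Space (Nov V) :=
  IsTopologicalAddGroup.t2Space_of_zero_sep fun x hx => by
    by_contra! h
    refine hx (eq_zero_of_forall_mem_energy fun c => h _ ?_)
    exact hasBasis_nhds_zero.mem_of_mem trivial

theorem hasSum_iff_eventually_mem_energy {ι : Type*} {u : ι → Nov V} {s : Nov V} :
    HasSum u s ↔ ∀ c, ∀ᶠ S : Finset ι in atTop, s - ∑ i ∈ S, u i ∈ energy (Nov V) c :=
  tendsto_iff_eventually_mem_energy

theorem HasEnergySum.of_hasSum {u : ℕ → Nov V} {s : Nov V} (h : HasSum u s) :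
    HasEnergySum u s := fun c =>
  eventually_atTop.1 (tendsto_iff_eventually_mem_energy.1 h.tendsto_sum_nat c)

/-- Completeness: a family with only finitely many members outside `T^c` for each `c` is
summable, since every coefficient of the sum is a finite sum. -/
theorem summable_of_finite_notMem_energy {ι : Type*} {u : ι → Nov V}
    (h : ∀ c, {i | u i ∉ energy (Nov V) c}.Finite) : Summable u := by
  have hfin : ∀ c, ∀ l < c, ∀ S : Finset ι, (h c).toFinset ⊆ S →
      ∑ᶠ i, (u i).coeff l = ∑ i ∈ S, (u i).coeff l := fun c l hl S hS => by
    refine finsum_eq_sum_of_support_subset _ fun i hi => hS ?_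
    exact (h c).mem_toFinset.2 fun hi' => hi (mem_energy_iff.1 hi' l hl)
  refine ⟨Nov.ofCoeff (fun l => ∑ᶠ i, (u i).coeff l) fun c => ?_, ?_⟩
  · refine ((∑ i ∈ (h (c + 1)).toFinset, u i).finite_support c).subset ?_
    rintro l ⟨hl, h0⟩
    refine ⟨hl, ?_⟩
    rwa [Nov.coeff_sum, ← hfin (c + 1) l (hl.trans_lt (lt_add_one c)) _ subset_rfl]
  · refine hasSum_iff_eventually_mem_energy.2 fun c => ?_
    filter_upwards [eventually_ge_atTop (h c).toFinset] with S hS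
    refine mem_energy_iff.2 fun l hl => ?_
    rw [Nov.coeff_sub, Nov.coeff_ofCoeff, Nov.coeff_sum, hfin c l hl S hS, sub_self]

/-- A family is summable if its energies grow linearly with a weight whose sublevel sets are
finite. -/
theorem summable_of_mem_energy_nsmul {ι : Type*} {u : ι → Nov V} {δ : ℝ≥0} (hδ : 0 < δ)
    (w : ι → ℕ) (hw : ∀ N, {i | w i < N}.Finite) (h : ∀ i, u i ∈ energy (Nov V) (w i • δ)) :
    Summable u :=
  summable_of_finite_notMem_energy fun c => by
    obtain ⟨N, hN⟩ := Archimedean.arch c hδ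
    refine (hw N).subset fun i hi => ?_
    by_contra hi'
    refine hi (energy_anti (hN.trans ?_) (h i))
    exact nsmul_le_nsmul_left zero_le (not_lt.1 hi')

theorem summable_nat_of_mem_energy {u : ℕ → Nov V} {δ : ℝ≥0} (hδ : 0 < δ)
    (h : ∀ k : ℕ, u k ∈ energy (Nov V) (k • δ)) : Summable u :=
  summable_of_mem_energy_nsmul hδ id (fun N => Set.finite_lt_nat N) h

theorem hasSum_mem_energy {ι : Type*} {u : ι → Nov V} {s : Nov V} {c : ℝ≥0} (h : HasSum u s)
    (hu : ∀ i, u i ∈ energy (Nov V) c) : s ∈ energy (Nov V) c := by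
  obtain ⟨S, hS⟩ := (hasSum_iff_eventually_mem_energy.1 h c).exists
  simpa using add_mem hS (sum_mem fun i (_ : i ∈ S) => hu i)

theorem hasSum_mem_homog {ι : Type*} {𝒱 : ℤ → Submodule ℂ V} {p : ℤ} {u : ι → Nov V} {s : Nov V}
    (h : HasSum u s) (hu : ∀ i, u i ∈ homog 𝒱 p) : s ∈ homog 𝒱 p := fun l => by
  obtain ⟨S, hS⟩ := (hasSum_iff_eventually_mem_energy.1 h (l + 1)).exists
  have := mem_energy_iff.1 hS l (lt_add_one l)
  rw [Nov.coeff_sub, sub_eq_zero] at this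
  rw [this]
  exact (sum_mem fun i (_ : i ∈ S) => hu i : ∑ i ∈ S, u i ∈ homog 𝒱 p) l

theorem continuous_linearMap {W : Type*} [AddCommGroup W] [Module ℂ W]
    (φ : Nov V →ₗ[NovikovRing] Nov W) : Continuous φ :=
  continuous_of_continuousAt_zero φ (by
    rw [ContinuousAt, map_zero]
    exact (hasBasis_nhds_zero.tendsto_iff hasBasis_nhds_zero).2
      fun c _ => ⟨c, trivial, fun x hx => map_mem_energy φ hx⟩)

theorem hasSum_linearMap {W ι : Type*} [AddCommGroup W] [Module ℂ W]
    (φ : Nov V →ₗ[NovikovRing] Nov W) {u : ι → Nov V} {s : Nov V} (h : HasSum u s) :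
    HasSum (fun i => φ (u i)) (φ s) :=
  h.map φ (continuous_linearMap φ)

theorem hasSum_antidiagonal {u : ℕ × ℕ → Nov V} {s : Nov V} (h : HasSum u s) :
    HasSum (fun k => ∑ p ∈ Finset.HasAntidiagonal.antidiagonal k, u p) s := by
  refine ((Finset.HasAntidiagonal.sigmaAntidiagonalEquivProd (A := ℕ)).hasSum_iff.2 h).sigma
    fun k => ?_
  exact Finset.hasSum (Finset.HasAntidiagonal.antidiagonal k) u

end Energy

/-! ### Energy estimates for multilinear maps -/

section MultiMap

variable {V W : Type*} [AddCommGroup V] [Module ℂ V] [AddCommGroup W] [Module ℂ W]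

/-- The linear map `x ↦ F(p, x, q)`. -/
def MultiMap.slot {R X Y : Type*} [Ring R] [AddCommGroup X] [Module R X]
    [AddCommGroup Y] [Module R Y] (F : MultiMap R X Y) (p q : List X) : X →ₗ[R] Y where
  toFun x := F.toFun (p ++ x :: q)
  map_add' x y := F.map_add p x y q
  map_smul' c x := F.map_smul p c x q

@[simp] theorem MultiMap.slot_apply {R X Y : Type*} [Ring R] [AddCommGroup X] [Module R X]
    [AddCommGroup Y] [Module R Y] (F : MultiMap R X Y) (p q : List X) (x : X) :
    F.slot p q x = F.toFun (p ++ x :: q) := rfl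

theorem MultiMap.map_zero {R X Y : Type*} [Ring R] [AddCommGroup X] [Module R X]
    [AddCommGroup Y] [Module R Y] (F : MultiMap R X Y) (p q : List X) :
    F.toFun (p ++ 0 :: q) = 0 := (F.slot p q).map_zero

theorem slot_mem_energy (F : MultiMap NovikovRing (Nov V) (Nov W)) {l₀ l : ℝ≥0}
    (hF : ∀ x, F.toFun x ∈ energy (Nov W) l₀) (p q : List (Nov V)) {x : Nov V}
    (hx : x ∈ energy (Nov V) l) : F.toFun (p ++ x :: q) ∈ energy (Nov W) (l + l₀) := by
  obtain ⟨y, rfl⟩ := mem_energy_iff_exists.1 hx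
  rw [F.map_smul]
  exact Tpow_smul_mem_energy l (hF _)

/-- A multilinear map with values in `T^{l₀}` adds up the energies of its inputs. -/
theorem toFun_mem_energy_sum (F : MultiMap NovikovRing (Nov V) (Nov W)) {l₀ : ℝ≥0}
    (hF : ∀ x, F.toFun x ∈ energy (Nov W) l₀) {x : List (Nov V)} {l : List ℝ≥0}
    (h : List.Forall₂ (fun y c => y ∈ energy (Nov V) c) x l) (p : List (Nov V)) :
    F.toFun (p ++ x) ∈ energy (Nov W) (l.sum + l₀) := by
  induction h generalizing p with
  | nil => simpa using hF p
  | @cons a c x l ha _ ih =>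
    obtain ⟨y, rfl⟩ := mem_energy_iff_exists.1 ha
    rw [F.map_smul, List.sum_cons, add_assoc, List.append_cons]
    exact Tpow_smul_mem_energy c (ih _)

theorem forall₂_replicate {α β : Type*} (R : α → β → Prop) {a : α} {b : β} (h : R a b) (n : ℕ) :
    List.Forall₂ R (List.replicate n a) (List.replicate n b) := by
  induction n with
  | zero => exact .nil
  | succ n ih => exact .cons h ih

theorem forall₂_energy_replicate {x : Nov V} {δ : ℝ≥0} (hx : x ∈ energy (Nov V) δ) (n : ℕ) :
    List.Forall₂ (fun y c => y ∈ energy (Nov V) c) (List.replicate n x) (List.replicate n δ) :=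
  forall₂_replicate (fun (y : Nov V) (c : ℝ≥0) => y ∈ energy (Nov V) c) hx n

theorem toFun_replicate_mem_energy (F : MultiMap NovikovRing (Nov V) (Nov W)) {l₀ δ : ℝ≥0}
    (hF : ∀ x, F.toFun x ∈ energy (Nov W) l₀) {x : Nov V} (hx : x ∈ energy (Nov V) δ) (k : ℕ) :
    F.toFun (List.replicate k x) ∈ energy (Nov W) (k • δ + l₀) := by
  simpa using toFun_mem_energy_sum F hF (forall₂_energy_replicate hx k) []

/-- Replacing `x` by `x'` changes `F(x, …, x)` by a sum of terms which contain `x - x'` once and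
elements of `T^δ` in all other places. -/
theorem toFun_replicate_sub_mem_energy (F : MultiMap NovikovRing (Nov V) (Nov W)) {l₀ δ s : ℝ≥0}
    (hF : ∀ x, F.toFun x ∈ energy (Nov W) l₀) {x x' : Nov V} (hx : x ∈ energy (Nov V) δ)
    (hx' : x' ∈ energy (Nov V) δ) (hxx' : x - x' ∈ energy (Nov V) s) (k : ℕ) :
    F.toFun (List.replicate (k + 1) x) - F.toFun (List.replicate (k + 1) x') ∈
      energy (Nov W) (s + k • δ + l₀) := by
  suffices H : ∀ k j : ℕ,
      F.toFun (List.replicate j x ++ List.replicate (k + 1) x) -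
        F.toFun (List.replicate j x ++ List.replicate (k + 1) x') ∈
          energy (Nov W) (s + (k + j) • δ + l₀) by
    simpa using H k 0
  intro k
  induction k with
  | zero =>
    intro j
    have h := toFun_mem_energy_sum F hF
      (List.rel_append (forall₂_energy_replicate hx j) (.cons hxx' .nil)) []
    have h' := (F.slot (List.replicate j x) []).map_sub x x'
    simp only [MultiMap.slot_apply] at h'
    simpa [h', add_comm] using h
  | succ k ih =>
    intro j
    have h1 := ih (j + 1)
    have h2 := toFun_mem_energy_sum F hF
      (List.rel_append (forall₂_energy_replicate hx j)
        (.cons hxx' (forall₂_energy_replicate hx' (k + 1)))) []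
    have h' := (F.slot (List.replicate j x) (List.replicate (k + 1) x')).map_sub x x'
    simp only [MultiMap.slot_apply] at h'
    rw [List.nil_append, h'] at h2
    rw [List.replicate_succ' (n := j), List.append_assoc, List.append_assoc, List.singleton_append,
      List.singleton_append, ← List.replicate_succ] at h1
    have e1 : (List.replicate j δ ++ s :: List.replicate (k + 1) δ).sum
        = s + (k + (j + 1)) • δ := by
      simp only [List.sum_append, List.sum_cons, List.sum_replicate]
      rw [add_left_comm, ← add_nsmul]
      congr 2
      omega
    rw [e1] at h2
    have e2 : k + 1 + j = k + (j + 1) := by omega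
    rw [e2, List.replicate_succ (n := k + 1) (a := x')]
    simpa using add_mem h1 h2

/-- The family of maps `x ↦ n(x | y | z)`. -/
def BiMultiMap.left {R X M Z : Type*} [CommRing R] [AddCommGroup X] [Module R X]
    [AddCommGroup M] [Module R M] [AddCommGroup Z] [Module R Z] (n : BiMultiMap R X M Z)
    (y : M) (z : List Z) : MultiMap R X M where
  toFun x := n.toFun x y z
  map_add p x x' q := n.map_add_left p x x' q y z
  map_smul p c x q := n.map_smul_left p c x q y z

@[simp] theorem BiMultiMap.left_apply {R X M Z : Type*} [CommRing R] [AddCommGroup X] [Module R X]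
    [AddCommGroup M] [Module R M] [AddCommGroup Z] [Module R Z] (n : BiMultiMap R X M Z)
    (y : M) (z : List Z) (x : List X) : (n.left y z).toFun x = n.toFun x y z := rfl

/-- The linear map `y ↦ n(x | y | z)`. -/
def BiMultiMap.mid {R X M Z : Type*} [CommRing R] [AddCommGroup X] [Module R X]
    [AddCommGroup M] [Module R M] [AddCommGroup Z] [Module R Z] (n : BiMultiMap R X M Z)
    (x : List X) (z : List Z) : M →ₗ[R] M where
  toFun y := n.toFun x y z
  map_add' y y' := n.map_add_mid x y y' z
  map_smul' c y := n.map_smul_mid x c y z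

@[simp] theorem BiMultiMap.mid_apply {R X M Z : Type*} [CommRing R] [AddCommGroup X] [Module R X]
    [AddCommGroup M] [Module R M] [AddCommGroup Z] [Module R Z] (n : BiMultiMap R X M Z)
    (x : List X) (z : List Z) (y : M) : n.mid x z y = n.toFun x y z := rfl

end MultiMap

/-! ### Push-forward of Maurer–Cartan elements -/

section Push

variable {V W : Type*} [AddCommGroup V] [Module ℂ V] [AddCommGroup W] [Module ℂ W]

/-- The value `∑ₖ g(x, …, x)` of a family `g` of multilinear maps at an element `x` of positive
energy; for an `A_∞` homomorphism this is the push-forward of cochains. -/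
def pushforward (g : MultiMap NovikovRing (Nov V) (Nov W)) (x : Nov V) : Nov W :=
  ∑' k : ℕ, g.toFun (List.replicate k x)

variable (g : MultiMap NovikovRing (Nov V) (Nov W)) {δ : ℝ≥0} {x x' : Nov V}

theorem hasSum_pushforward (hδ : 0 < δ) (hx : x ∈ energy (Nov V) δ) :
    HasSum (fun k => g.toFun (List.replicate k x)) (pushforward g x) :=
  (summable_nat_of_mem_energy hδ fun k => by
    simpa using toFun_replicate_mem_energy g (fun _ => mem_energy_zero _) hx k).hasSum

theorem hasSum_pushforward_succ (h0 : g.toFun [] = 0) (hδ : 0 < δ) (hx : x ∈ energy (Nov V) δ) :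
    HasSum (fun k => g.toFun (List.replicate (k + 1) x)) (pushforward g x) := by
  rw [hasSum_nat_add_iff (f := fun k => g.toFun (List.replicate k x)) 1]
  simpa [h0] using hasSum_pushforward g hδ hx

theorem pushforward_mem_energy (h0 : g.toFun [] = 0) (hδ : 0 < δ) (hx : x ∈ energy (Nov V) δ) :
    pushforward g x ∈ energy (Nov W) δ :=
  hasSum_mem_energy (hasSum_pushforward_succ g h0 hδ hx) fun k => by
    have h := toFun_replicate_mem_energy g (fun _ => mem_energy_zero _) hx (k + 1)
    exact energy_anti (by rw [succ_nsmul, add_zero]; exact le_add_self) h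

/-- To leading order the push-forward depends on `x` through the linear part of `g` only. -/
theorem pushforward_sub_mem_energy (hδ : 0 < δ) (hx : x ∈ energy (Nov V) δ)
    (hx' : x' ∈ energy (Nov V) δ) {s : ℝ≥0} (hxx' : x - x' ∈ energy (Nov V) s) :
    pushforward g x - pushforward g x' - g.toFun [x - x'] ∈ energy (Nov W) (s + δ) := by
  have h := (hasSum_nat_add_iff' 2).2 ((hasSum_pushforward g hδ hx).sub
    (hasSum_pushforward g hδ hx'))
  have h2 := (g.slot [] []).map_sub x x'
  simp only [MultiMap.slot_apply, List.nil_append] at h2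
  simp only [Finset.sum_range_succ, Finset.sum_range_zero, List.replicate_one, List.replicate_zero,
    sub_self, zero_add, ← h2] at h
  refine hasSum_mem_energy h fun k => ?_
  have h3 := toFun_replicate_sub_mem_energy g (fun _ => mem_energy_zero _) hx hx' hxx' (k + 1)
  refine energy_anti ?_ h3
  rw [succ_nsmul, add_zero, ← add_assoc, add_right_comm]
  exact le_self_add

theorem pushforward_sub_mem_energy' (hδ : 0 < δ) (hx : x ∈ energy (Nov V) δ)
    (hx' : x' ∈ energy (Nov V) δ) {s : ℝ≥0} (hxx' : x - x' ∈ energy (Nov V) s) :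
    pushforward g x - pushforward g x' ∈ energy (Nov W) s := by
  have h1 := energy_anti (le_self_add : s ≤ s + δ) (pushforward_sub_mem_energy g hδ hx hx' hxx')
  have h2 : g.toFun [x - x'] ∈ energy (Nov W) s := by
    simpa using slot_mem_energy g (fun _ => mem_energy_zero _) [] [] hxx'
  simpa using add_mem h1 h2

theorem hasDegrees_replicate {𝒱 : ℤ → Submodule ℂ V} (hx : x ∈ homog 𝒱 1) (k : ℕ) :
    HasDegrees 𝒱 (List.replicate k x) (List.replicate k 1) :=
  forall₂_replicate (fun (y : Nov V) (i : ℤ) => y ∈ homog 𝒱 i) hx k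

theorem pushforward_mem_homog {𝒱 : ℤ → Submodule ℂ V} {𝒲 : ℤ → Submodule ℂ W}
    (hg : HasShift 𝒱 𝒲 1 g) (hδ : 0 < δ) (hx : x ∈ energy (Nov V) δ) (hx1 : x ∈ homog 𝒱 1) :
    pushforward g x ∈ homog 𝒲 1 :=
  hasSum_mem_homog (hasSum_pushforward g hδ hx) fun k => by
    simpa using hg _ _ (hasDegrees_replicate hx1 k)

/-- Lists of natural numbers correspond to compositions, by adding one to each entry. -/
def listEquivComposition : List ℕ ≃ Σ n, Composition n where
  toFun L := ⟨(L.map Nat.succ).sum, L.map Nat.succ, by simp, rfl⟩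
  invFun c := c.2.blocks.map Nat.pred
  left_inv L := by simp [Function.comp_def]
  right_inv := by
    rintro ⟨n, c, hc, rfl⟩
    have h : (c.map Nat.pred).map Nat.succ = c := by
      rw [List.map_map]
      exact (List.map_congr_left fun i hi => Nat.succ_pred_eq_of_pos (hc hi)).trans (List.map_id c)
    have key : ∀ (c' : List ℕ) (_ : c' = c) (h1 : ∀ {i}, i ∈ c' → 0 < i),
        (⟨c'.sum, c', h1, rfl⟩ : Σ n, Composition n) = ⟨c.sum, c, hc, rfl⟩ := by
      rintro c' rfl _
      rfl
    exact key _ h (by simp)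

theorem splitWrtComposition_replicate {α : Type*} (a : α) (n : ℕ)
    (c : Composition (List.replicate n a).length) :
    (List.replicate n a).splitWrtComposition c = c.blocks.map fun j => List.replicate j a := by
  rw [List.eq_iff_flatten_eq]
  refine ⟨?_, ?_⟩
  · rw [List.flatten_splitWrtComposition, eq_comm, List.eq_replicate_iff]
    refine ⟨?_, fun b hb => ?_⟩
    · simp [List.length_flatten, Function.comp_def]
    · obtain ⟨l, hl, hb⟩ := List.mem_flatten.1 hb
      obtain ⟨j, -, rfl⟩ := List.mem_map.1 hl
      exact List.eq_of_mem_replicate hb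
  · rw [List.map_length_splitWrtComposition, List.map_map]
    simp [Function.comp_def]

theorem finite_lists_sum_succ_lt (N : ℕ) : {L : List ℕ | (L.map Nat.succ).sum < N}.Finite := by
  refine Set.Finite.of_finite_image (f := listEquivComposition) ?_
    listEquivComposition.injective.injOn
  refine (Finset.finite_toSet
    ((Finset.range N).sigma fun n => (Finset.univ : Finset (Composition n)))).subset ?_
  rintro _ ⟨L, hL, rfl⟩
  simpa [listEquivComposition] using hL

variable (F : MultiMap NovikovRing (Nov V) (Nov W)) {t : ℕ → Nov V}

theorem sum_map_succ_nsmul (L : List ℕ) (δ : ℝ≥0) :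
    (L.map fun j => (j + 1) • δ).sum = (L.map Nat.succ).sum • δ := by
  induction L with
  | nil => simp
  | cons j L ih =>
    rw [List.map_cons, List.sum_cons, List.map_cons, List.sum_cons, ih, ← add_nsmul]

theorem summable_toFun_map (hδ : 0 < δ) (ht : ∀ j, t j ∈ energy (Nov V) ((j + 1) • δ))
    {ι : Type*} {e : ι → List ℕ} (he : Function.Injective e) (p : List (Nov V)) :
    Summable fun i => F.toFun (p ++ (e i).map t) := by
  refine summable_of_mem_energy_nsmul hδ (fun i => ((e i).map Nat.succ).sum)
    (fun N => (finite_lists_sum_succ_lt N).preimage he.injOn) fun i => ?_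
  have h : List.Forall₂ (fun y c => y ∈ energy (Nov V) c) ((e i).map t)
      ((e i).map fun j => (j + 1) • δ) := by
    rw [List.forall₂_map_left_iff, List.forall₂_map_right_iff, List.forall₂_same]
    exact fun j _ => ht j
  have h1 := toFun_mem_energy_sum F (fun _ => mem_energy_zero _) h p
  rwa [sum_map_succ_nsmul, add_zero] at h1

/-- Multilinear expansion of `F(p, a, …, a)` for a convergent sum `a = ∑ⱼ t j`. -/
theorem hasSum_toFun_ofFn (hδ : 0 < δ) (ht : ∀ j, t j ∈ energy (Nov V) ((j + 1) • δ)) {a : Nov V}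
    (ha : HasSum t a) (r : ℕ) (p : List (Nov V)) :
    HasSum (fun c : Fin r → ℕ => F.toFun (p ++ (List.ofFn c).map t))
      (F.toFun (p ++ List.replicate r a)) := by
  induction r generalizing p with
  | zero => simp
  | succ r ih =>
    obtain ⟨s, hs⟩ := summable_toFun_map F hδ ht (List.ofFn_injective (n := r + 1)) p
    have h1 := ((Fin.consEquiv fun _ : Fin (r + 1) => ℕ).hasSum_iff.2 hs).prod_fiberwise
      (g := fun j => F.toFun (p ++ t j :: List.replicate r a)) fun j => by
        simpa [Fin.consEquiv, Function.comp_def] using ih (p ++ [t j])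
    have h2 : HasSum (fun j => F.toFun (p ++ t j :: List.replicate r a))
        (F.toFun (p ++ a :: List.replicate r a)) :=
      hasSum_linearMap (F.slot p (List.replicate r a)) ha
    rw [h1.unique h2] at hs
    exact hs

theorem cutSum_replicate {X Y Z : Type*} [AddCommGroup Z] (f : List X → Y) (F : List Y → Z) (x : X)
    (n : ℕ) : cutSum f F (List.replicate n x) =
      ∑ c : Composition n, F (c.blocks.map fun j => f (List.replicate j x)) := by
  have key : ∀ m, m = n → ∑ c : Composition m, F (c.blocks.map fun j => f (List.replicate j x)) =
      ∑ c : Composition n, F (c.blocks.map fun j => f (List.replicate j x)) := by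
    rintro m rfl
    rfl
  rw [← key _ (List.length_replicate (n := n) (a := x))]
  refine Finset.sum_congr rfl fun c _ => ?_
  rw [splitWrtComposition_replicate, List.map_map]
  rfl

/-- Expanding `∑ᵣ F(a, …, a)` for `a = ∑ⱼ g(x, …, x)` and sorting by the total number of
arguments `x`, one obtains the sums `cutSum` over all compositions. -/
theorem hasSum_toFun_pushforward (F : MultiMap NovikovRing (Nov W) (Nov W))
    (h0 : g.toFun [] = 0) (hδ : 0 < δ) (hx : x ∈ energy (Nov V) δ)
    (hcut : ∀ n, cutSum g.toFun F.toFun (List.replicate n x) = 0) :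
    HasSum (fun r => F.toFun (List.replicate r (pushforward g x))) 0 := by
  set t : ℕ → Nov W := fun j => g.toFun (List.replicate (j + 1) x) with ht
  have htE : ∀ j, t j ∈ energy (Nov W) ((j + 1) • δ) := fun j => by
    simpa using toFun_replicate_mem_energy g (fun _ => mem_energy_zero _) hx (j + 1)
  obtain ⟨s, hs⟩ := summable_toFun_map F hδ htE Function.injective_id []
  -- sorting the lists by their length
  have hlen : HasSum (fun r => F.toFun (List.replicate r (pushforward g x))) s :=
    (List.equivSigmaTuple.symm.hasSum_iff.2 hs).sigma fun r =>
      hasSum_toFun_ofFn F hδ htE (hasSum_pushforward_succ g h0 hδ hx) r []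
  -- sorting the lists by the total number of arguments `x`
  have hcomp : HasSum (fun _ : ℕ => (0 : Nov W)) s := by
    refine (listEquivComposition.symm.hasSum_iff.2 hs).sigma fun n => ?_
    have h := hasSum_fintype fun c : Composition n =>
      F.toFun (c.blocks.map fun j => g.toFun (List.replicate j x))
    rw [← cutSum_replicate, hcut] at h
    refine h.congr_fun fun c => congrArg F.toFun ?_
    have h1 : ∀ j ∈ c.blocks, g.toFun (List.replicate (j.pred + 1) x) =
        g.toFun (List.replicate j x) := fun j hj => by
      rw [← Nat.succ_eq_add_one, Nat.succ_pred_eq_of_pos (c.blocks_pos hj)]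
    rw [← List.map_congr_left h1]
    simp [listEquivComposition, Function.comp_def, ht]
  rwa [hcomp.unique hasSum_zero] at hlen

end Push

/-! ### Cocycles of an anti-commutative algebra push forward to bounding cochains -/

section MaurerCartan

variable {V V' : Type*} [AddCommGroup V] [Module ℂ V] [AddCommGroup V'] [Module ℂ V']
  {𝒱 : ℤ → Submodule ℂ V} {𝒱' : ℤ → Submodule ℂ V'}

theorem Nov.eq_zero_of_neg_eq {x : Nov V} (h : -x = x) : x = 0 :=
  Nov.ext fun l => by
    have h1 : -x.coeff l = x.coeff l := congrArg (fun y => Nov.coeff y l) h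
    have h2 : (2 : ℂ) • x.coeff l = 0 := by
      rw [two_smul]
      nth_rw 1 [← h1]
      exact neg_add_cancel _
    exact (smul_eq_zero.1 h2).resolve_left two_ne_zero

/-- In an anti-commutative algebra odd elements square to zero, so every cocycle of degree `1`
solves the Maurer–Cartan equation term by term. -/
theorem AInfAlgebra.IsAnticommutativeDGA.toFun_replicate_eq_zero {A : AInfAlgebra 𝒱}
    (hA : A.IsAnticommutativeDGA) {x : Nov V} (hx : x ∈ homog 𝒱 1) (hdx : A.m.toFun [x] = 0)
    (k : ℕ) : A.m.toFun (List.replicate k x) = 0 := by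
  by_cases h1 : k = 1
  · subst h1
    exact hdx
  by_cases h2 : k = 2
  · subst h2
    have h := hA.comm 1 1 x x hx hx
    refine Nov.eq_zero_of_neg_eq ?_
    simpa [sgn] using h
  · exact hA.eq_zero _ (by simpa using h1) (by simpa using h2)

theorem insertSum_eq_zero {X Y : Type*} [AddCommGroup X] [Module NovikovRing X] [AddCommGroup Y]
    [Module NovikovRing Y] {m : List X → X} (f : MultiMap NovikovRing X Y) {x : X}
    (hm : ∀ k, m (List.replicate k x) = 0) (d : List ℤ) (n : ℕ) :
    insertSum m f.toFun d (List.replicate n x) = 0 := by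
  refine Finset.sum_eq_zero fun i _ => Finset.sum_eq_zero fun j _ => ?_
  have h : m (((List.replicate n x).drop i).take j) = 0 := by
    rw [List.drop_replicate, List.take_replicate, hm]
  rw [h, f.map_zero, smul_zero]

/-- The push-forward of a degree `1` cocycle of an anti-commutative algebra solves the
Maurer–Cartan equation. -/
theorem AInfHom.hasSum_toFun_replicate_pushforward {A' : AInfAlgebra 𝒱'} {A : AInfAlgebra 𝒱}
    (g : AInfHom A' A) (hA' : A'.IsAnticommutativeDGA) {δ : ℝ≥0} (hδ : 0 < δ) {x : Nov V'}
    (hx : x ∈ homog 𝒱' 1) (hxδ : x ∈ energy (Nov V') δ) (hdx : A'.m.toFun [x] = 0) :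
    HasSum (fun k => A.m.toFun (List.replicate k (pushforward g.f x))) 0 :=
  hasSum_toFun_pushforward g.f A.m g.map_nil hδ hxδ fun n => by
    rw [← g.relation _ _ (hasDegrees_replicate hx n)]
    exact insertSum_eq_zero g.f (hA'.toFun_replicate_eq_zero hx hdx) _ n

end MaurerCartan

/-! ### The deformed differential of a bimodule -/

section DeformedDifferential

variable {U V W : Type*} [AddCommGroup U] [Module ℂ U] [AddCommGroup V] [Module ℂ V]
  [AddCommGroup W] [Module ℂ W] {𝒰 : ℤ → Submodule ℂ U} {𝒱 : ℤ → Submodule ℂ V}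
  {𝒲 : ℤ → Submodule ℂ W} {A : AInfAlgebra 𝒰} {B : AInfAlgebra 𝒱}

/-- The deformed differential `y ↦ ∑ₖ m^{k|1|0}(a, …, a, y)`, for `a` of positive energy. -/
def AInfBimodule.deformedDiff (M : AInfBimodule A B 𝒲) (a : Nov U) (y : Nov W) : Nov W :=
  pushforward (M.n.left y []) a

variable (M : AInfBimodule A B 𝒲) {δ : ℝ≥0} {a : Nov U}

theorem AInfBimodule.hasSum_deformedDiff (hδ : 0 < δ) (ha : a ∈ energy (Nov U) δ) (y : Nov W) :
    HasSum (fun k => M.n.toFun (List.replicate k a) y []) (M.deformedDiff a y) :=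
  hasSum_pushforward (M.n.left y []) hδ ha

theorem AInfBimodule.deformedDiff_smul (hδ : 0 < δ) (ha : a ∈ energy (Nov U) δ) (c : NovikovRing)
    (y : Nov W) : M.deformedDiff a (c • y) = c • M.deformedDiff a y := by
  have h := hasSum_linearMap (LinearMap.lsmul NovikovRing (Nov W) c)
    (M.hasSum_deformedDiff hδ ha y)
  refine (M.hasSum_deformedDiff hδ ha (c • y)).unique ?_
  simpa only [M.n.map_smul_mid, LinearMap.lsmul_apply] using h

theorem AInfBimodule.deformedDiff_mem_homog (hδ : 0 < δ) (ha : a ∈ energy (Nov U) δ)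
    (ha1 : a ∈ homog 𝒰 1) {p : ℤ} {y : Nov W} (hy : y ∈ homog 𝒲 p) :
    M.deformedDiff a y ∈ homog 𝒲 (p + 1) :=
  hasSum_mem_homog (M.hasSum_deformedDiff hδ ha y) fun k => by
    have h := M.degree _ _ y p [] [] (hasDegrees_replicate ha1 k) hy .nil
    have e : (List.replicate k (1 : ℤ)).sum + p + ([] : List ℤ).sum + 1
        - (List.replicate k a).length - ([] : List (Nov V)).length = p + 1 := by
      simp
      ring
    rwa [e] at h

theorem sgn_club_replicate_one {i k : ℕ} (h : i ≤ k) : sgn (club (List.replicate k 1) i) = 1 := by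
  have e : club (List.replicate k 1) i = 2 * (i : ℤ) := by
    simp [club, List.take_replicate, min_eq_left h]
    ring
  rw [e, sgn, Int.negOnePow_two_mul, Units.val_one]

theorem insertSum_replicate {X Y : Type*} [AddCommGroup Y] (m : List X → X) (f : List X → Y)
    (a : X) (k : ℕ) :
    insertSum m f (List.replicate k 1) (List.replicate k a) =
      ∑ p ∈ Finset.HasAntidiagonal.antidiagonal k,
        ∑ q ∈ Finset.HasAntidiagonal.antidiagonal p.2,
          f (List.replicate p.1 a ++ m (List.replicate q.1 a) :: List.replicate q.2 a) := by
  rw [Finset.Nat.sum_antidiagonal_eq_sum_range_succ_mk]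
  unfold insertSum
  rw [List.length_replicate]
  refine Finset.sum_congr rfl fun i hi => ?_
  have hi' : i ≤ k := Nat.lt_succ_iff.1 (Finset.mem_range.1 hi)
  rw [Finset.Nat.sum_antidiagonal_eq_sum_range_succ_mk]
  rw [Nat.succ_sub hi' |>.symm]
  refine Finset.sum_congr rfl fun j hj => ?_
  have hj' : j < k + 1 - i := Finset.mem_range.1 hj
  rw [sgn_club_replicate_one hi', one_smul, List.take_replicate, List.drop_replicate,
    List.take_replicate, List.drop_replicate, min_eq_left hi', min_eq_left (by omega),
    Nat.sub_add_eq]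

/-- The square of the differential deformed by a Maurer–Cartan element is zero: the sum over `k` of
the bimodule relations for the inputs `a, …, a, y`. -/
theorem AInfBimodule.deformedDiff_deformedDiff (hB : B.TautUnobstructed) (hδ : 0 < δ)
    (ha : a ∈ energy (Nov U) δ) (ha1 : a ∈ homog 𝒰 1)
    (hMC : HasSum (fun k => A.m.toFun (List.replicate k a)) 0) {p : ℤ} {y : Nov W}
    (hy : y ∈ homog 𝒲 p) : M.deformedDiff a (M.deformedDiff a y) = 0 := by
  -- the terms in which two bimodule operations are composed
  set u : ℕ × ℕ → Nov W := fun q =>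
    M.n.toFun (List.replicate q.1 a) (M.n.toFun (List.replicate q.2 a) y []) [] with hu
  -- the terms in which an operation of `A` is applied first
  set v : ℕ × ℕ × ℕ → Nov W := fun q => M.n.toFun
    (List.replicate q.1 a ++ A.m.toFun (List.replicate q.2.1 a) :: List.replicate q.2.2 a) y []
    with hv
  have hfin2 : ∀ N, {q : ℕ × ℕ | q.1 + q.2 < N}.Finite := fun N =>
    ((Set.finite_lt_nat N).prod (Set.finite_lt_nat N)).subset fun q hq => by
      have : q.1 + q.2 < N := hq
      exact ⟨show q.1 < N by omega, show q.2 < N by omega⟩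
  have hfin3 : ∀ N, {q : ℕ × ℕ × ℕ | q.1 + q.2.1 + q.2.2 < N}.Finite := fun N =>
    ((Set.finite_lt_nat N).prod ((Set.finite_lt_nat N).prod (Set.finite_lt_nat N))).subset
      fun q hq => by
        have : q.1 + q.2.1 + q.2.2 < N := hq
        exact ⟨show q.1 < N by omega, show q.2.1 < N by omega, show q.2.2 < N by omega⟩
  have hbase : ∀ (L : List (Nov U)) (y : Nov W), (M.n.left y []).toFun L ∈ energy (Nov W) 0 :=
    fun _ _ => mem_energy_zero _
  obtain ⟨s, hs⟩ : Summable u := summable_of_mem_energy_nsmul hδ (fun q => q.1 + q.2) hfin2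
    fun q => by
      have h1 := toFun_replicate_mem_energy (M.n.left y []) (fun L => hbase L y) ha q.2
      obtain ⟨w, hw⟩ := mem_energy_iff_exists.1 h1
      rw [BiMultiMap.left_apply, add_zero] at hw
      rw [hu]
      dsimp only
      rw [hw, M.n.map_smul_mid, add_nsmul, add_comm]
      refine Tpow_smul_mem_energy _ ?_
      simpa using toFun_replicate_mem_energy (M.n.left w []) (fun L => hbase L w) ha q.1
  have hs1 : s = M.deformedDiff a (M.deformedDiff a y) :=
    (hs.prod_fiberwise fun i => hasSum_linearMap (M.n.mid (List.replicate i a) [])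
      (M.hasSum_deformedDiff hδ ha y)).unique (M.hasSum_deformedDiff hδ ha _)
  obtain ⟨t, ht⟩ : Summable v := summable_of_mem_energy_nsmul hδ
    (fun q => q.1 + q.2.1 + q.2.2) hfin3 fun q => by
      have hm : A.m.toFun (List.replicate q.2.1 a) ∈ energy (Nov U) (q.2.1 • δ) := by
        simpa using toFun_replicate_mem_energy A.m (fun _ => mem_energy_zero _) ha q.2.1
      have h := toFun_mem_energy_sum (M.n.left y []) (fun L => hbase L y)
        (List.rel_append (forall₂_energy_replicate ha q.1)
          (.cons hm (forall₂_energy_replicate ha q.2.2))) []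
      have e : (List.replicate q.1 δ ++ (q.2.1 • δ) :: List.replicate q.2.2 δ).sum
          = (q.1 + q.2.1 + q.2.2) • δ := by
        rw [List.sum_append, List.sum_cons, List.sum_replicate, List.sum_replicate, add_nsmul,
          add_nsmul, add_assoc]
      rw [e, add_zero] at h
      exact h
  have ht1 : t = 0 := by
    -- summation over the inner operation first inserts `∑ₖ m^k(a, …, a) = 0`
    have h1 := (Equiv.prodAssoc ℕ ℕ ℕ).hasSum_iff.2
      (((Equiv.refl ℕ).prodCongr (Equiv.prodComm ℕ ℕ)).hasSum_iff.2 ht)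
    refine (h1.prod_fiberwise (g := fun _ => 0) fun q => ?_).unique hasSum_zero
    have h2 := hasSum_linearMap ((M.n.left y []).slot (List.replicate q.1 a)
      (List.replicate q.2 a)) hMC
    rwa [map_zero] at h2
  have hrel : ∀ k, ∑ q ∈ Finset.HasAntidiagonal.antidiagonal k, u q = -
      ∑ q ∈ Finset.HasAntidiagonal.antidiagonal k,
        ∑ r ∈ Finset.HasAntidiagonal.antidiagonal q.2, v (q.1, r) := fun k => by
    have h := M.relation _ _ y p [] [] (hasDegrees_replicate ha1 k) hy .nil
    have h3 : M.n.toFun (List.replicate k a) y [B.m.toFun []] = 0 := by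
      have hB' : B.m.toFun [] = 0 := hB
      simpa [hB'] using M.n.map_smul_right (List.replicate k a) y [] 0 0 []
    rw [insertSum_replicate] at h
    rw [eq_neg_iff_add_eq_zero, add_comm, ← h]
    simp only [List.length_nil, zero_add, Finset.sum_range_one, insertSum, List.take_nil,
      List.drop_nil, List.nil_append, h3, smul_zero, add_zero, Nat.sub_zero,
      List.length_replicate]
    congr 1
    rw [Finset.Nat.sum_antidiagonal_eq_sum_range_succ_mk]
    refine Finset.sum_congr rfl fun i hi => ?_
    have hi' : i ≤ k := Nat.lt_succ_iff.1 (Finset.mem_range.1 hi)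
    rw [sgn_club_replicate_one hi', one_smul, List.take_replicate, List.drop_replicate,
      min_eq_left hi']
  have hu' := hasSum_antidiagonal hs
  simp only [hrel] at hu'
  have hv' : HasSum (fun q : ℕ × ℕ =>
      ∑ r ∈ Finset.HasAntidiagonal.antidiagonal q.2, v (q.1, r)) t := by
    let e : (Σ q : ℕ × ℕ, Finset.HasAntidiagonal.antidiagonal q.2) ≃ ℕ × ℕ × ℕ :=
      { toFun := fun r => (r.1.1, r.2.1)
        invFun := fun r => ⟨(r.1, r.2.1 + r.2.2), r.2,
          Finset.HasAntidiagonal.mem_antidiagonal.2 rfl⟩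
        left_inv := by
          rintro ⟨⟨i, n⟩, ⟨j, l⟩, h⟩
          obtain rfl : j + l = n := Finset.HasAntidiagonal.mem_antidiagonal.1 h
          rfl
        right_inv := fun _ => rfl }
    exact (e.hasSum_iff.2 ht).sigma fun q =>
      Finset.hasSum (Finset.HasAntidiagonal.antidiagonal q.2) fun r => v (q.1, r)
  rw [← hs1, hu'.unique (hasSum_antidiagonal hv').neg, ht1, neg_zero]

end DeformedDifferential

/-! ### Representing classes by cocycles of the model -/

section Model

variable {U V W U' : Type*} [AddCommGroup U] [Module ℂ U] [AddCommGroup V] [Module ℂ V]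
  [AddCommGroup W] [Module ℂ W] [AddCommGroup U'] [Module ℂ U']
  {𝒰 : ℤ → Submodule ℂ U} {𝒱 : ℤ → Submodule ℂ V} {𝒲 : ℤ → Submodule ℂ W}
  {𝒰' : ℤ → Submodule ℂ U'} {A : AInfAlgebra 𝒰} {B : AInfAlgebra 𝒱} {A' : AInfAlgebra 𝒰'}

theorem cutSum_nil {X Y Z : Type*} [AddCommGroup Z] (f : List X → Y) (F : List Y → Z) :
    cutSum f F [] = F [] := by
  have : Subsingleton (Composition ([] : List X).length) :=
    Fintype.card_le_one_iff_subsingleton.1 (by rw [composition_card]; simp)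
  exact (Fintype.sum_eq_single (⟨[], by simp, rfl⟩ : Composition ([] : List X).length)
    fun c hc => absurd (Subsingleton.elim c _) hc).trans rfl

theorem cutSum_singleton {X Y Z : Type*} [AddCommGroup Z] (f : List X → Y) (F : List Y → Z)
    (x : X) : cutSum f F [x] = F [f [x]] := by
  have : Subsingleton (Composition 1) :=
    Fintype.card_le_one_iff_subsingleton.1 (by rw [composition_card]; simp)
  refine (cutSum_replicate f F x 1).trans ?_
  rw [Fintype.sum_eq_single (⟨[1], by simp, rfl⟩ : Composition 1)]
  · rfl
  · exact fun c hc => absurd (Subsingleton.elim c _) hc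

/-- The linear part of an `A_∞` homomorphism maps cocycles to cocycles. -/
theorem AInfHom.map_cocycle (f : AInfHom A A') (hA : A.TautUnobstructed) {i : ℤ} {b : Nov U}
    (hb : b ∈ homog 𝒰 i) (hdb : A.m.toFun [b] = 0) : A'.m.toFun [f.f.toFun [b]] = 0 := by
  have h := f.relation [b] [i] (.cons hb .nil)
  have hA' : A.m.toFun [] = 0 := hA
  have h1 : f.f.toFun [0, b] = 0 := f.f.map_zero [] [b]
  have h2 : f.f.toFun [b, 0] = 0 := f.f.map_zero [b] []
  have h3 : f.f.toFun [0] = 0 := f.f.map_zero [] []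
  rw [cutSum_singleton] at h
  rw [← h]
  simp [insertSum, Finset.sum_range_succ, hA', hdb, h1, h2, h3]

/-- A homotopy from `g ∘ f` to the identity changes a cocycle by a coboundary. -/
theorem exists_comp_sub_eq_of_homotopic {f : AInfHom A A'} {g : AInfHom A' A}
    (hgf : Homotopic A A (g.comp f) idFamily) (hA : A.TautUnobstructed) {i : ℤ} {b : Nov U}
    (hb : b ∈ homog 𝒰 i) (hdb : A.m.toFun [b] = 0) :
    ∃ w ∈ homog 𝒰 (i - 1), g.f.toFun [f.f.toFun [b]] - b = A.m.toFun [w] := by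
  obtain ⟨h, hdeg, h0, hrel⟩ := hgf
  refine ⟨h.toFun [b], by simpa using hdeg [b] [i] (.cons hb .nil), ?_⟩
  have H := hrel [b] [i] (.cons hb .nil)
  have hA' : A.m.toFun [] = 0 := hA
  have h1 : h.toFun [0, b] = 0 := h.map_zero [] [b]
  have h2 : h.toFun [b, 0] = 0 := h.map_zero [b] []
  have h3 : h.toFun [0] = 0 := h.map_zero [] []
  have h4 : ∀ z, A.m.toFun [0, z] = 0 := fun z => A.m.map_zero [] [z]
  have h5 : ∀ z, A.m.toFun [z, 0] = 0 := fun z => A.m.map_zero [z] []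
  simpa [AInfHom.comp, cutSum_singleton, cutSum_nil, insertSum, Finset.sum_range_succ, hA', hdb,
    h0, h1, h2, h3, h4, h5, club, sgn, idFamily] using H

/-- If multiplication by `e₀` is surjective on cohomology, every degree `1` cocycle of
`T^{l₀} M / T^{l₁} M` is represented by a product with a cocycle coming from the model. -/
theorem exists_cocycle_of_surjective (M : AInfBimodule A B 𝒲) (hA : A.TautUnobstructed)
    (hB : B.TautUnobstructed) {f : AInfHom A A'} {g : AInfHom A' A}
    (hgf : Homotopic A A (g.comp f) idFamily) (hA' : A'.TautUnobstructed)
    {l₀ l₁ : ℝ≥0} (hM : M.LeftProductsIn l₀)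
    {e₀ : Nov W} (he₀ : e₀ ∈ homog 𝒲 0) (hde₀ : M.n.diff e₀ ∈ energy (Nov W) l₁)
    (hsurj : Function.Surjective (M.mulOnH1 hA hB hM e₀ he₀ hde₀))
    {y : Nov W} (hy : y ∈ homog 𝒲 1) (hy₀ : y ∈ energy (Nov W) l₀)
    (hdy : M.n.toFun [] y [] ∈ energy (Nov W) l₁) :
    ∃ c ∈ homog 𝒰' 1, A'.m.toFun [c] = 0 ∧ ∃ z ∈ homog 𝒲 0, z ∈ energy (Nov W) l₀ ∧
      y - M.n.toFun [g.f.toFun [c]] e₀ [] - M.n.toFun [] z [] ∈ energy (Nov W) l₁ := by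
  obtain ⟨α, hα⟩ := hsurj (Submodule.Quotient.mk ⟨y, ⟨hy, hy₀⟩, hdy⟩)
  obtain ⟨⟨b, hb⟩, rfl⟩ := Submodule.Quotient.mk_surjective _ α
  have hb1 : b ∈ homog 𝒰 1 := hb.1.1
  have hdb : A.m.toFun [b] = 0 := hb.2
  have hc1 : f.f.toFun [b] ∈ homog 𝒰' 1 := by
    simpa using f.degree [b] [1] (.cons hb1 .nil)
  have hdc := f.map_cocycle hA hb1 hdb
  have hb'1 : g.f.toFun [f.f.toFun [b]] ∈ homog 𝒰 1 := by
    simpa using g.degree [f.f.toFun [b]] [1] (.cons hc1 .nil)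
  have hdb' := g.map_cocycle hA' hc1 hdc
  obtain ⟨w, hw, hgfb⟩ := exists_comp_sub_eq_of_homotopic hgf hA hb1 hdb
  have hb' : g.f.toFun [f.f.toFun [b]] ∈ cocycles 𝒰 A.m.linear ⊤ ⊥ 1 :=
    ⟨⟨hb'1, trivial⟩, hdb'⟩
  have hclass : (Submodule.Quotient.mk ⟨_, hb'⟩ : Cohomology 𝒰 A.m.linear ⊤ ⊥ 1) =
      Submodule.Quotient.mk ⟨b, hb⟩ :=
    (Submodule.Quotient.eq _).2 (Submodule.mem_sup_left ⟨w, ⟨hw, trivial⟩, hgfb.symm⟩)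
  rw [← hclass] at hα
  have hmem := (Submodule.Quotient.eq _).1 hα.symm
  obtain ⟨_, ⟨z, ⟨hz, hz₀⟩, rfl⟩, r, ⟨-, hr⟩, hsum⟩ := Submodule.mem_sup.1 hmem
  refine ⟨_, hc1, hdc, z, by simpa using hz, hz₀, ?_⟩
  have hsum' : M.n.toFun [] z [] + r = y - M.n.toFun [g.f.toFun [f.f.toFun [b]]] e₀ [] := hsum
  rw [← hsum', add_sub_cancel_left]
  exact hr

end Model

/-! ### The obstruction argument -/

section Obstruction

variable {U V W U' : Type*} [AddCommGroup U] [Module ℂ U] [AddCommGroup V] [Module ℂ V]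
  [AddCommGroup W] [Module ℂ W] [AddCommGroup U'] [Module ℂ U']
  {𝒰 : ℤ → Submodule ℂ U} {𝒱 : ℤ → Submodule ℂ V} {𝒲 : ℤ → Submodule ℂ W}
  {𝒰' : ℤ → Submodule ℂ U'} {A : AInfAlgebra 𝒰} {B : AInfAlgebra 𝒱} {A' : AInfAlgebra 𝒰'}
  (M : AInfBimodule A B 𝒲) {l₀ δ s : ℝ≥0}

theorem AInfBimodule.deformedDiff_sub_mem_energy (hδ : 0 < δ) {a a' : Nov U}
    (ha : a ∈ energy (Nov U) δ) (ha' : a' ∈ energy (Nov U) δ)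
    (haa' : a - a' ∈ energy (Nov U) s) {e e' : Nov W} (hee' : e - e' ∈ energy (Nov W) s) :
    M.deformedDiff a e - M.deformedDiff a' e' ∈ energy (Nov W) s := by
  have h1 : M.deformedDiff a e - M.deformedDiff a' e ∈ energy (Nov W) s :=
    pushforward_sub_mem_energy' (M.n.left e []) hδ ha ha' haa'
  have h2 : M.deformedDiff a' e - M.deformedDiff a' e' ∈ energy (Nov W) s :=
    hasSum_mem_energy ((M.hasSum_deformedDiff hδ ha' e).sub (M.hasSum_deformedDiff hδ ha' e'))
      fun k => by
        have h := map_mem_energy (M.n.mid (List.replicate k a') []) hee'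
        rwa [map_sub] at h
  simpa using add_mem h1 h2

theorem AInfBimodule.LeftProductsIn.toFun_replicate_mem {M : AInfBimodule A B 𝒲}
    (hM : M.LeftProductsIn l₀) {a : Nov U} (ha : a ∈ energy (Nov U) δ) {y : Nov W}
    (k : ℕ) : M.n.toFun (List.replicate (k + 1) a) y [] ∈ energy (Nov W) (l₀ + δ) :=
  energy_anti (by rw [succ_nsmul, add_comm l₀]; gcongr; exact le_add_self)
    (toFun_replicate_mem_energy (M.n.left y []) (fun x => hM x y) ha (k + 1))

/-- Subtracting `T^s b` (up to higher order) from `a` and `T^s z` from `e` lowers the deformed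
differential of `e` by `T^s (m^{1|1|0}(b, e₀) + m^{0|1|0}(z))`, modulo `T^{s + l₀ + δ}`. -/
theorem AInfBimodule.deformedDiff_update {M : AInfBimodule A B 𝒲} (hM : M.LeftProductsIn l₀)
    (hδ : 0 < δ) {a a' b : Nov U} (ha : a ∈ energy (Nov U) δ)
    (ha' : a' ∈ energy (Nov U) δ) (hb : a - a' - Tpow s • b ∈ energy (Nov U) (s + δ))
    {e e₀ : Nov W} (he : e - e₀ ∈ energy (Nov W) (l₀ + δ)) (z : Nov W) :
    M.deformedDiff a e - M.deformedDiff a' (e - Tpow s • z)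
      - Tpow s • (M.n.toFun [b] e₀ [] + M.n.toFun [] z []) ∈ energy (Nov W) (s + (l₀ + δ)) := by
  have haa' : a - a' ∈ energy (Nov U) s := by
    have h := Tpow_smul_mem_energy s (mem_energy_zero b)
    rw [add_zero] at h
    simpa using add_mem (energy_anti le_self_add hb) h
  have hmid : ∀ L : List (Nov U), M.n.toFun L (e - Tpow s • z) [] =
      M.n.toFun L e [] - Tpow s • M.n.toFun L z [] := fun L => by
    have h := (M.n.mid L []).map_sub e (Tpow s • z)
    rwa [map_smul] at h
  -- the contributions of three or more inputs
  have htail := (hasSum_nat_add_iff' 2).2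
    ((M.hasSum_deformedDiff hδ ha e).sub (M.hasSum_deformedDiff hδ ha' (e - Tpow s • z)))
  have h2 := hasSum_mem_energy (c := s + (l₀ + δ)) htail fun k => by
    rw [hmid, sub_sub_eq_add_sub, add_sub_right_comm]
    refine add_mem ?_ (Tpow_smul_mem_energy s (hM.toFun_replicate_mem ha' (k + 1)))
    have h := toFun_replicate_sub_mem_energy (M.n.left e []) (fun x => hM x e) ha ha' haa' (k + 1)
    refine energy_anti ?_ h
    rw [succ_nsmul, add_comm l₀, ← add_assoc]
    gcongr
    exact le_add_self
  -- the contribution of two inputs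
  have h1 : M.n.toFun [a] e [] - M.n.toFun [a'] (e - Tpow s • z) [] - Tpow s • M.n.toFun [b] e₀ []
      ∈ energy (Nov W) (s + (l₀ + δ)) := by
    have e1 : M.n.toFun [a - a' - Tpow s • b] e [] =
        M.n.toFun [a] e [] - M.n.toFun [a'] e [] - Tpow s • M.n.toFun [b] e [] := by
      have h : ∀ y, M.n.mulRight e y = M.n.toFun [y] e [] := fun _ => rfl
      rw [← h, map_sub, map_sub, map_smul, h, h, h]
    have e2 : M.n.toFun [b] (e - e₀) [] = M.n.toFun [b] e [] - M.n.toFun [b] e₀ [] :=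
      (M.n.mid [b] []).map_sub e e₀
    have t1 : M.n.toFun [a - a' - Tpow s • b] e [] ∈ energy (Nov W) (s + (l₀ + δ)) := by
      have h := slot_mem_energy (M.n.left e []) (fun x => hM x e) [] [] hb
      exact energy_anti (by rw [add_comm l₀, add_assoc]) h
    have t2 := Tpow_smul_mem_energy s (map_mem_energy (M.n.mid [b] []) he)
    have t3 := Tpow_smul_mem_energy s (hM.toFun_replicate_mem (y := z) ha' 0)
    rw [BiMultiMap.mid_apply, e2] at t2
    have h := add_mem (add_mem t1 t2) t3
    rw [e1] at h
    convert h using 1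
    rw [hmid, smul_sub]
    simp only [zero_add, List.replicate_one]
    abel
  have h := add_mem h2 h1
  convert h using 1
  simp only [Finset.sum_range_succ, Finset.sum_range_zero, List.replicate_one, List.replicate_zero,
    hmid, smul_add]
  abel

/-- One step of the construction. If the deformed differential of `e` vanishes modulo
`T^{s + l₀}`, then `T^{-s}` times it is a cocycle of `T^{l₀} M / T^{l₀ + δ} M`; writing this cocycle
as a product with `e₀` plus a coboundary gives a correction of `x` and `e` of order `T^s`, after
which the deformed differential vanishes modulo `T^{s + l₀ + δ}`. -/
theorem exists_correction {M : AInfBimodule A B 𝒲} (hB : B.TautUnobstructed)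
    (hA' : A'.IsAnticommutativeDGA) (g : AInfHom A' A) (hM : M.LeftProductsIn l₀) (hδ : 0 < δ)
    {e₀ : Nov W}
    (hrep : ∀ y ∈ homog 𝒲 1, y ∈ energy (Nov W) l₀ → M.n.toFun [] y [] ∈ energy (Nov W) (l₀ + δ) →
      ∃ c ∈ homog 𝒰' 1, A'.m.toFun [c] = 0 ∧ ∃ z ∈ homog 𝒲 0, z ∈ energy (Nov W) l₀ ∧
        y - M.n.toFun [g.f.toFun [c]] e₀ [] - M.n.toFun [] z [] ∈ energy (Nov W) (l₀ + δ))
    (hs : δ ≤ s) {x : Nov U'} {e : Nov W} (hx : x ∈ homog 𝒰' 1) (hxδ : x ∈ energy (Nov U') δ)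
    (hdx : A'.m.toFun [x] = 0) (he : e ∈ homog 𝒲 0) (hee₀ : e - e₀ ∈ energy (Nov W) (l₀ + δ))
    (hD : M.deformedDiff (pushforward g.f x) e ∈ energy (Nov W) (s + l₀)) :
    ∃ (x' : Nov U') (e' : Nov W), x' ∈ homog 𝒰' 1 ∧ x' ∈ energy (Nov U') δ ∧
      A'.m.toFun [x'] = 0 ∧ e' ∈ homog 𝒲 0 ∧ e' - e₀ ∈ energy (Nov W) (l₀ + δ) ∧
      M.deformedDiff (pushforward g.f x') e' ∈ energy (Nov W) (s + (l₀ + δ)) ∧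
      x' - x ∈ energy (Nov U') s ∧ e' - e ∈ energy (Nov W) s := by
  have ha := pushforward_mem_energy g.f g.map_nil hδ hxδ
  have ha1 : pushforward g.f x ∈ homog 𝒰 1 := pushforward_mem_homog g.f g.degree hδ hxδ hx
  set a := pushforward g.f x
  obtain ⟨y₀, hy₀⟩ := mem_energy_iff_exists.1 hD
  rw [Tpow_add, mul_smul] at hy₀
  set y := Tpow l₀ • y₀ with hy
  have hyl : y ∈ energy (Nov W) l₀ := mem_energy_iff_exists.2 ⟨y₀, rfl⟩
  have hy1 : y ∈ homog 𝒲 1 := mem_homog_of_Tpow_smul_mem (a := s) (by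
    rw [← hy₀]
    simpa using M.deformedDiff_mem_homog hδ ha ha1 he)
  have hDy : M.deformedDiff a y = 0 := Tpow_smul_injective s (by
    change Tpow s • _ = Tpow s • (0 : Nov W)
    rw [← M.deformedDiff_smul hδ ha, ← hy₀, smul_zero]
    exact M.deformedDiff_deformedDiff hB hδ ha ha1
      (g.hasSum_toFun_replicate_pushforward hA' hδ hx hxδ hdx) he)
  have hdy : M.n.toFun [] y [] ∈ energy (Nov W) (l₀ + δ) := by
    have h := (hasSum_nat_add_iff' 1).2 (M.hasSum_deformedDiff hδ ha y)
    have h1 := hasSum_mem_energy h fun k => hM.toFun_replicate_mem ha k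
    rw [hDy] at h1
    simpa using h1
  obtain ⟨c, hc, hdc, z, hz, hzl, hyc⟩ := hrep y hy1 hyl hdy
  have hTc : Tpow s • c ∈ energy (Nov U') s := mem_energy_iff_exists.2 ⟨c, rfl⟩
  have hx'δ : x - Tpow s • c ∈ energy (Nov U') δ := sub_mem hxδ (energy_anti hs hTc)
  have hxx' : x - (x - Tpow s • c) = Tpow s • c := sub_sub_cancel _ _
  have ha' := pushforward_mem_energy g.f g.map_nil hδ hx'δ
  refine ⟨x - Tpow s • c, e - Tpow s • z, sub_mem hx (Submodule.smul_mem _ _ hc), hx'δ, ?_,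
    sub_mem he (Submodule.smul_mem _ _ hz), ?_, ?_, ?_, ?_⟩
  · have h : ∀ w, A'.m.linear w = A'.m.toFun [w] := fun _ => rfl
    rw [← h, map_sub, map_smul, h, h, hdx, hdc, smul_zero, sub_zero]
  · rw [sub_right_comm]
    refine sub_mem hee₀ (energy_anti ?_ (Tpow_smul_mem_energy s hzl))
    rw [add_comm l₀]
    gcongr
  · have hb : a - pushforward g.f (x - Tpow s • c) - Tpow s • g.f.toFun [c] ∈
        energy (Nov U) (s + δ) := by
      have h := pushforward_sub_mem_energy g.f hδ hxδ hx'δ (s := s) (by rwa [hxx'])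
      have e1 : g.f.toFun [Tpow s • c] = Tpow s • g.f.toFun [c] := g.f.linear.map_smul _ _
      rwa [hxx', e1] at h
    have h1 := AInfBimodule.deformedDiff_update hM hδ ha ha' hb hee₀ z
    have h2 := Tpow_smul_mem_energy s hyc
    have h := sub_mem h2 h1
    rw [hy₀] at h
    convert h using 1
    simp only [smul_add, smul_sub]
    abel
  · rw [sub_sub_cancel_left]
    exact neg_mem hTc
  · rw [sub_sub_cancel_left]
    exact neg_mem (mem_energy_iff_exists.2 ⟨z, rfl⟩)

/-- Completeness for sequences whose increments have linearly growing energy. -/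
theorem exists_limit_of_sub_mem_energy {X : Type*} [AddCommGroup X] [Module ℂ X] (hδ : 0 < δ)
    {x : ℕ → Nov X} (h : ∀ n, x (n + 1) - x n ∈ energy (Nov X) ((n + 1) • δ)) :
    ∃ y, ∀ n, y - x n ∈ energy (Nov X) ((n + 1) • δ) := by
  obtain ⟨s, hs⟩ := summable_nat_of_mem_energy hδ fun n =>
    energy_anti (nsmul_le_nsmul_left zero_le (Nat.le_succ n)) (h n)
  refine ⟨x 0 + s, fun n => ?_⟩
  have h1 := (hasSum_nat_add_iff' n).2 hs
  rw [Finset.sum_range_sub, sub_sub_eq_add_sub, add_comm s] at h1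
  refine hasSum_mem_energy h1 fun k => energy_anti ?_ (h (k + n))
  exact nsmul_le_nsmul_left zero_le (by omega)

theorem mem_homog_of_forall_sub_mem_energy {X : Type*} [AddCommGroup X] [Module ℂ X]
    {𝒳 : ℤ → Submodule ℂ X} {i : ℤ} (hδ : 0 < δ) {x : ℕ → Nov X} {y : Nov X}
    (hx : ∀ n, x n ∈ homog 𝒳 i) (h : ∀ n, y - x n ∈ energy (Nov X) ((n + 1) • δ)) :
    y ∈ homog 𝒳 i := fun l => by
  obtain ⟨n, hn⟩ := Archimedean.arch (l + 1) hδ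
  have h1 := mem_energy_iff.1 (h n) l ((lt_add_one l).trans_le
    (hn.trans (nsmul_le_nsmul_left zero_le (Nat.le_succ n))))
  rw [Nov.coeff_sub, sub_eq_zero] at h1
  rw [h1]
  exact hx n l

end Obstruction

end

end FilteredAInfinity

theorem mainTheorem10
    -- the underlying graded vector spaces of `A`, `B`, `M` and of the model `A'`
    {U V W U' : Type*} [AddCommGroup U] [Module ℂ U] [AddCommGroup V] [Module ℂ V]
    [AddCommGroup W] [Module ℂ W] [AddCommGroup U'] [Module ℂ U']
    {𝒰 : ℤ → Submodule ℂ U} {𝒱 : ℤ → Submodule ℂ V} {𝒲 : ℤ → Submodule ℂ W}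
    {𝒰' : ℤ → Submodule ℂ U'}
    -- the monoids of energies
    {GA GB GM GA' : Type*} [AddCommMonoid GA] [AddCommMonoid GB] [AddCommMonoid GM]
    [AddCommMonoid GA'] (EA : EnergyMonoid GA) (EB : EnergyMonoid GB) (EM : EnergyMonoid GM)
    (EA' : EnergyMonoid GA')
    -- the gapped `(A, B)`-bimodule `M`
    (A : AInfAlgebra 𝒰) (B : AInfAlgebra 𝒱) (M : AInfBimodule A B 𝒲)
    (hAgap : A.IsGapped EA) (hBgap : B.IsGapped EB) (hMgap : M.IsGapped EA EB EM)
    (hA : A.TautUnobstructed) (hB : B.TautUnobstructed)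
    -- the anti-commutative DGA model `A'` of `A`
    (A' : AInfAlgebra 𝒰') (hA'gap : A'.IsGapped EA') (hA' : A'.IsAnticommutativeDGA)
    (f : AInfHom A A') (g : AInfHom A' A) (hf : f.IsGapped EA EA') (hg : g.IsGapped EA' EA)
    (hgf : g.IsHomotopyInverse f)
    -- the energy levels, and the cocycle `e₀` of `M / T^{l₁} M`
    (l₀ l₁ : ℝ≥0) (hl : l₀ < l₁) (hM : M.LeftProductsIn l₀)
    (e₀ : Nov W) (he₀ : e₀ ∈ homog 𝒲 0) (hde₀ : M.n.diff e₀ ∈ energy (Nov W) l₁)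
    (hsurj : Function.Surjective (M.mulOnH1 hA hB hM e₀ he₀ hde₀)) :
    ∃ (a : Nov U) (e : Nov W), A.IsBounding a ∧ e ∈ homog 𝒲 0 ∧
      e - e₀ ∈ energy (Nov W) l₁ ∧ M.DeformedDiffEq a e 0 := by
  -- from here on `l₁ = l₀ + δ`
  obtain ⟨δ, rfl⟩ := exists_add_of_le hl.le
  have hδ : 0 < δ := pos_of_lt_add_right hl
  have hrep := fun y (hy : y ∈ homog 𝒲 1) hy₀ hdy =>
    exists_cocycle_of_surjective M hA hB hgf.1 (hA'.eq_zero [] (by simp) (by simp)) hM he₀ hde₀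
      hsurj (y := y) hy hy₀ hdy
  -- the `n`-th approximation solves the equation modulo `T^{l₁ + n δ}`, where
  -- `l₁ + n δ = (n + 1) δ + l₀`
  let P : ℕ → Nov U' × Nov W → Prop := fun n q =>
    q.1 ∈ homog 𝒰' 1 ∧ q.1 ∈ energy (Nov U') δ ∧ A'.m.toFun [q.1] = 0 ∧ q.2 ∈ homog 𝒲 0 ∧
      q.2 - e₀ ∈ energy (Nov W) (l₀ + δ) ∧
      M.deformedDiff (pushforward g.f q.1) q.2 ∈ energy (Nov W) ((n + 1) • δ + l₀)
  have hstep : ∀ (n : ℕ) (q : {q // P n q}), ∃ q' : {q // P (n + 1) q},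
      q'.1.1 - q.1.1 ∈ energy (Nov U') ((n + 1) • δ) ∧
      q'.1.2 - q.1.2 ∈ energy (Nov W) ((n + 1) • δ) := by
    rintro n ⟨⟨x, e⟩, hx, hxδ, hdx, he, hee₀, hD⟩
    obtain ⟨x', e', hx', hxδ', hdx', he', hee₀', hD', hxx', hee'⟩ :=
      exists_correction hB hA' g hM hδ hrep (s := (n + 1) • δ)
        (by rw [succ_nsmul]; exact le_add_self) hx hxδ hdx he hee₀ hD
    rw [add_comm l₀, ← add_assoc, ← succ_nsmul] at hD'
    exact ⟨⟨(x', e'), hx', hxδ', hdx', he', hee₀', hD'⟩, hxx', hee'⟩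
  have h0 : P 0 (0, e₀) := by
    refine ⟨zero_mem _, zero_mem _, A'.m.map_zero [] [], he₀, by simp, ?_⟩
    have hp : pushforward g.f (0 : Nov U') = 0 := by
      refine eq_zero_of_forall_mem_energy fun c => ?_
      exact energy_anti le_self_add
        (pushforward_mem_energy g.f g.map_nil (add_pos_of_nonneg_of_pos (zero_le (a := c)) one_pos)
          (zero_mem _))
    have hz := M.hasSum_deformedDiff hδ (zero_mem _ : (0 : Nov U) ∈ energy (Nov U) δ) e₀
    have hz' := hz.unique (hasSum_single 0 fun k hk => by
      obtain ⟨k, rfl⟩ := Nat.exists_eq_succ_of_ne_zero hk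
      exact (M.n.left e₀ []).map_zero [] (List.replicate k 0))
    rw [hp, hz', zero_add, one_nsmul, add_comm]
    exact hde₀
  choose F hF using hstep
  let q : (n : ℕ) → {q // P n q} := fun n => Nat.rec ⟨_, h0⟩ F n
  have hq : ∀ n, q (n + 1) = F n (q n) := fun _ => rfl
  obtain ⟨x, hx⟩ := exists_limit_of_sub_mem_energy hδ (x := fun n => (q n).1.1) fun n => by
    rw [hq]
    exact (hF n (q n)).1
  obtain ⟨e, he⟩ := exists_limit_of_sub_mem_energy hδ (x := fun n => (q n).1.2) fun n => by
    rw [hq]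
    exact (hF n (q n)).2
  have hx1 : x ∈ homog 𝒰' 1 := mem_homog_of_forall_sub_mem_energy hδ (fun n => (q n).2.1) hx
  have hxδ : x ∈ energy (Nov U') δ := by
    have h := hx 0
    rw [zero_add, one_nsmul] at h
    simpa using add_mem h (q 0).2.2.1
  have hdx : A'.m.toFun [x] = 0 := eq_zero_of_forall_mem_energy_nsmul hδ fun n => by
    have h := map_mem_energy A'.m.linear (hx n)
    have h1 : A'.m.linear (q n).1.1 = 0 := (q n).2.2.2.1
    rw [map_sub, h1, sub_zero] at h
    exact energy_anti (nsmul_le_nsmul_left zero_le (Nat.le_succ n)) h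
  have ha := pushforward_mem_energy g.f g.map_nil hδ hxδ
  have hD : M.deformedDiff (pushforward g.f x) e = 0 :=
    eq_zero_of_forall_mem_energy_nsmul hδ fun n => by
      have hqδ := (q n).2.2.1
      have h := M.deformedDiff_sub_mem_energy hδ ha
        (pushforward_mem_energy g.f g.map_nil hδ hqδ)
        (pushforward_sub_mem_energy' g.f hδ hxδ hqδ (hx n)) (he n)
      have h1 := energy_anti le_self_add (q n).2.2.2.2.2.2
      have h2 := add_mem h h1
      rw [sub_add_cancel] at h2
      exact energy_anti (nsmul_le_nsmul_left zero_le (Nat.le_succ n)) h2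
  refine ⟨pushforward g.f x, e, ⟨⟨pushforward_mem_homog g.f g.degree hδ hxδ hx1, δ, hδ, ha⟩,
    .of_hasSum (g.hasSum_toFun_replicate_pushforward hA' hδ hx1 hxδ hdx)⟩,
    mem_homog_of_forall_sub_mem_energy hδ (fun n => (q n).2.2.2.2.1) he, ?_, ?_⟩
  · obtain ⟨n, hn⟩ := Archimedean.arch (l₀ + δ) hδ
    have h1 := energy_anti (hn.trans (nsmul_le_nsmul_left zero_le (Nat.le_succ n))) (he n)
    simpa using add_mem h1 (q n).2.2.2.2.2.1
  · have h := M.hasSum_deformedDiff hδ ha e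
    rw [hD] at h
    exact .of_hasSum h
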